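/- **Setting.** Let $f:\mathbb R^n\to\mathbb R$ be differentiable, $L$-smooth ($L>0$, $\|\nabla f(x)-\nabla f(y)\|_2\le L\|x-y\|_2$ for all $x,y$) and $\mu$-strongly convex ($\mu>0$, $f(x)\ge f(y)+\langle\nabla f(y),x-y\rangle+\frac\mu2\|x-y\|_2^2$ for all $x,y$), and let $x^*$ be a minimizer of $f$. Stochastic gradients $\nabla f(x,\xi)$ (jointly measurable in $(x,\xi)$) satisfy, for every $x\in\mathbb R^n$, $\mathbb E_\xi[\nabla f(x,\xi)]=\nabla f(x)$ and $\mathbb E_\xi\|\nabla f(x,\xi)-\nabla f(x)\|_2^2\le\sigma^2$, where $\sigma\ge0$; no light-tail assumption is made. Let $\mathrm{clip}(v,\lambda)=\min\{1,\lambda/\|v\|_2\}\,v$. **Algorithms.** *clipped-SSTM* with starting point $x^0$, $N$ iterations, batch sizes $m_k$, stepsize parameter $a$ and clipping parameter $B$: set $A_0=\alpha_0=0$, $y^0=z^0=x^0$; for $k=0,\dots,N-1$ put $\alpha_{k+1}=\frac{k+2}{2aL}$, $A_{k+1}=A_k+\alpha_{k+1}$, $\lambda_{k+1}=B/\alpha_{k+1}$,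 $x^{k+1}=(A_ky^k+\alpha_{k+1}z^k)/A_{k+1}$, draw fresh i.i.d. samples $\xi^k_1,\dots,\xi^k_{m_k}$, and set $z^{k+1}=z^k-\alpha_{k+1}\,\mathrm{clip}\big(\frac1{m_k}\sum_{i=1}^{m_k}\nabla f(x^{k+1},\xi^k_i),\lambda_{k+1}\big)$, $y^{k+1}=(A_ky^k+\alpha_{k+1}z^{k+1})/A_{k+1}$. The output is $y^N$. *R-clipped-SSTM*: $\hat x^0=x^0$, and for $t=0,\dots,\tau-1$ the point $\hat x^{t+1}$ is the output of $N_0$ iterations of clipped-SSTM started at $\hat x^t$ with batch sizes $\{m^t_k\}_k$, stepsize parameter $a$ and clipping parameter $B_t$. **Parameters.** Let $C=\sqrt5$ and $R=\sqrt{2(f(x^0)-f(x^*))/\mu}$. For $\beta\in(0,1)$ and integers $\tau$ and $N_0\ge1$ write $\ell=\ln\frac{4N_0\tau}{\beta}$, and let $$m_k^t=\left\lceil\max\Big\{1,\frac{6000\cdot2^t\sigma^2\alpha_{k+1}^2N_0\,\ell}{C^2R^2},\frac{10368\cdot2^t\sigma^2\alpha_{k+1}^2N_0}{C^2R^2}\Big\}\right\rceil,\qquad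 B_t=\frac{CR}{8\cdot2^{t/2}\,\ell},$$ $$a_{\min}=\max\Big\{1,\frac{16\,\ell}{C},36\big(2\ell+\sqrt{4\ell^2+2\ell}\big)^2\Big\}$$ (if $R=0$, read $m_k^t=1$). **Theorem.** 1. If $\ell\ge2$, $a\ge a_{\min}$ and $N_0\ge C\sqrt{8aL/\mu}$, then after $\tau$ runs of clipped-SSTM in R-clipped-SSTM $$f(\hat x^\tau)-f(x^*)\le2^{-\tau}\big(f(x^0)-f(x^*)\big)$$ holds with probability at least $1-\beta$. 2. Let $C_1\ge C$ and $q>1$. There is a constant $K>0$ depending only on $C_1$ and $q$ such that the following holds. Let $\varepsilon>0$ and $\tau=\max\{0,\lceil\log_2\frac{\mu R^2}{2\varepsilon}\rceil\}$ (with $\tau=0$ if $R=0$), and suppose that $\ell\ge2$ (so in particular $\tau\geq 1$), $a=a_{\min}$ and $C\sqrt{8aL/\mu}\le N_0\le C_1\sqrt{8aL/\mu}$. Then $f(\hat x^\tau)-f(x^*)\le\varepsilon$ with probability at least $1-\beta$. Moreover, whenever $\frac{L}{\mu\beta}\ln\frac{\mu R^2}{\varepsilon}\ge q$, the total number of iterations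 satisfies $$N_0\tau\le K\sqrt{\frac L\mu}\,\ln\Big(\frac{\mu R^2}{\varepsilon}\Big)\ln\Big(\frac{L}{\mu\beta}\ln\frac{\mu R^2}{\varepsilon}\Big)$$ and the total number of oracle calls satisfies $$\sum_{t=0}^{\tau-1}\sum_{k=0}^{N_0-1}m_k^t\le K\max\Big\{\sqrt{\frac L\mu}\,\ln\frac{\mu R^2}{\varepsilon},\ \frac{\sigma^2}{\mu\varepsilon}\Big\}\ln\Big(\frac{L}{\mu\beta}\ln\frac{\mu R^2}{\varepsilon}\Big).$$ 3. There is a numerical constant $C_1\ge C$ such that for all $0<\mu\le L$, $\beta\in(0,1)$ and $\tau\ge1$ there is an integer $N_0\ge1$ with $\ell\ge2$ and $C\sqrt{8a_{\min}L/\mu}\le N_0\le C_1\sqrt{8a_{\min}L/\mu}$; that is, the choice of parameters required in part 2 is always possible. -/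

import Mathlib

open MeasureTheory ProbabilityTheory Finset
open scoped Gradient

namespace ClippedSSTM

noncomputable section

/-- `f` is `L`-smooth: differentiable with an `L`-Lipschitz gradient. -/
def IsSmooth {n : ℕ} (L : ℝ) (f : EuclideanSpace ℝ (Fin n) → ℝ) : Prop :=
  Differentiable ℝ f ∧ ∀ x y, ‖∇ f x - ∇ f y‖ ≤ L * ‖x - y‖

/-- A differentiable `f` is `μ`-strongly convex. -/
def IsStronglyConvex {n : ℕ} (μ : ℝ) (f : EuclideanSpace ℝ (Fin n) → ℝ) : Prop :=
  Differentiable ℝ f ∧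
    ∀ x y, f x ≥ f y + inner ℝ (∇ f y) (x - y) + μ / 2 * ‖x - y‖ ^ 2

/-- `g x s` is the stochastic gradient at `x` computed from the sample `s`; for `s` distributed
according to `P` it is an unbiased estimator of `∇ f x` with variance at most `σ ^ 2`. -/
structure IsStochasticGradient {n : ℕ} {S : Type*} [MeasurableSpace S] (P : Measure S) (σ : ℝ)
    (f : EuclideanSpace ℝ (Fin n) → ℝ)
    (g : EuclideanSpace ℝ (Fin n) → S → EuclideanSpace ℝ (Fin n)) : Prop where
  measurable : Measurable (Function.uncurry g)
  integrable : ∀ x, Integrable (g x) P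
  unbiased : ∀ x, ∫ s, g x s ∂P = ∇ f x
  integrable_sq : ∀ x, Integrable (fun s => ‖g x s - ∇ f x‖ ^ 2) P
  variance_le : ∀ x, ∫ s, ‖g x s - ∇ f x‖ ^ 2 ∂P ≤ σ ^ 2

/-- The samples `ξ t k i` (run `t`, iteration `k`, position `i` in the batch) are independent and
all have law `P`. -/
structure IsIIDSample {Ω S : Type*} [MeasurableSpace Ω] [MeasurableSpace S] (Pr : Measure Ω)
    (P : Measure S) (ξ : ℕ → ℕ → ℕ → Ω → S) : Prop where
  measurable : ∀ t k i, Measurable (ξ t k i)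
  law : ∀ t k i, Measure.map (ξ t k i) Pr = P
  indep : iIndepFun (fun (p : ℕ × ℕ × ℕ) => ξ p.1 p.2.1 p.2.2) Pr

/-- `clip(v, lam) = min {1, lam / ‖v‖} v`, which is `0` for `v = 0`. -/
def clip {n : ℕ} (v : EuclideanSpace ℝ (Fin n)) (lam : ℝ) : EuclideanSpace ℝ (Fin n) :=
  min 1 (lam / ‖v‖) • v

/-- The stepsizes: `alpha 0 = 0` and `alpha (k + 1) = (k + 2) / (2 a L)`. -/
def alpha (a L : ℝ) : ℕ → ℝ
  | 0 => 0
  | k + 1 => ((k : ℝ) + 2) / (2 * a * L)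

/-- `bigA k = alpha 0 + ... + alpha k`. -/
def bigA (a L : ℝ) : ℕ → ℝ
  | 0 => 0
  | k + 1 => bigA a L k + alpha a L (k + 1)

/-- The mini-batch stochastic gradient at `x`, from the samples `s 0, ..., s (m - 1)`. -/
def miniBatch {n : ℕ} {S : Type*} (g : EuclideanSpace ℝ (Fin n) → S → EuclideanSpace ℝ (Fin n))
    (m : ℕ) (s : ℕ → S) (x : EuclideanSpace ℝ (Fin n)) : EuclideanSpace ℝ (Fin n) :=
  (m : ℝ)⁻¹ • ∑ i ∈ range m, g x (s i)

/-- clipped-SSTM with stepsize parameter `a`, clipping parameter `B` and batch sizes `m k`, started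
at `x₀`: the pair `(y, z)` after the given number of iterations. Iteration `k` uses the samples
`s k 0, ..., s k (m k - 1)`. -/
def sstm {n : ℕ} {S : Type*} (g : EuclideanSpace ℝ (Fin n) → S → EuclideanSpace ℝ (Fin n))
    (L a B : ℝ) (m : ℕ → ℕ) (s : ℕ → ℕ → S) (x₀ : EuclideanSpace ℝ (Fin n)) :
    ℕ → EuclideanSpace ℝ (Fin n) × EuclideanSpace ℝ (Fin n)
  | 0 => (x₀, x₀)
  | k + 1 =>
    let y := (sstm g L a B m s x₀ k).1
    let z := (sstm g L a B m s x₀ k).2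
    let x := (bigA a L (k + 1))⁻¹ • (bigA a L k • y + alpha a L (k + 1) • z)
    let z' := z - alpha a L (k + 1) • clip (miniBatch g (m k) (s k) x) (B / alpha a L (k + 1))
    let y' := (bigA a L (k + 1))⁻¹ • (bigA a L k • y + alpha a L (k + 1) • z')
    (y', z')

/-- R-clipped-SSTM: the point obtained from `x₀` after the given number of runs of clipped-SSTM,
each with `N₀` iterations and started at the output of the preceding one; run `t` uses the
clipping parameter `B t`, the batch sizes `m t k` and the samples `s t k i`. -/
def restartedSSTM {n : ℕ} {S : Type*}
    (g : EuclideanSpace ℝ (Fin n) → S → EuclideanSpace ℝ (Fin n)) (L a : ℝ) (N₀ : ℕ)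
    (B : ℕ → ℝ) (m : ℕ → ℕ → ℕ) (s : ℕ → ℕ → ℕ → S) (x₀ : EuclideanSpace ℝ (Fin n)) :
    ℕ → EuclideanSpace ℝ (Fin n)
  | 0 => x₀
  | t + 1 => (sstm g L a (B t) (m t) (s t) (restartedSSTM g L a N₀ B m s x₀ t) N₀).1

/-- The number of stochastic gradients evaluated by `τ` runs of `N₀` iterations. -/
def oracleCalls (N₀ τ : ℕ) (m : ℕ → ℕ → ℕ) : ℕ :=
  ∑ t ∈ range τ, ∑ k ∈ range N₀, m t k

/-- `R = √(2 (f x₀ - f x⋆) / μ)`. -/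
def radius {n : ℕ} (μ : ℝ) (f : EuclideanSpace ℝ (Fin n) → ℝ)
    (x₀ xs : EuclideanSpace ℝ (Fin n)) : ℝ :=
  √(2 * (f x₀ - f xs) / μ)

/-- `ln (4 N₀ τ / β)`. -/
def logTerm (N₀ τ : ℕ) (β : ℝ) : ℝ :=
  Real.log (4 * N₀ * τ / β)

/-- The least admissible stepsize parameter, with `C = √5`. -/
def aMin (N₀ τ : ℕ) (β : ℝ) : ℝ :=
  max 1 (max (16 * logTerm N₀ τ β / √5)
    (36 * (2 * logTerm N₀ τ β + √(4 * logTerm N₀ τ β ^ 2 + 2 * logTerm N₀ τ β)) ^ 2))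

/-- The batch size of iteration `k` in run `t`, with `C = √5`, rounded up to an integer. -/
def batchSize (L a σ R β : ℝ) (N₀ τ : ℕ) (t k : ℕ) : ℕ :=
  ⌈max 1 (max
    (6000 * 2 ^ t * σ ^ 2 * alpha a L (k + 1) ^ 2 * N₀ * logTerm N₀ τ β / (√5 ^ 2 * R ^ 2))
    (10368 * 2 ^ t * σ ^ 2 * alpha a L (k + 1) ^ 2 * N₀ / (√5 ^ 2 * R ^ 2)))⌉₊

/-- The clipping parameter of run `t`, with `C = √5`: `C R_t / (8 ln (4 N₀ τ / β))` for
`R_t = R / 2 ^ (t / 2)`, real exponent. -/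
def clipParam (R β : ℝ) (N₀ τ : ℕ) (t : ℕ) : ℝ :=
  √5 * R / (8 * (2 : ℝ) ^ ((t : ℝ) / 2) * logTerm N₀ τ β)

/-- The output of `τ` runs of R-clipped-SSTM with the batch sizes `batchSize` and the clipping
parameters `clipParam`. -/
def output {n : ℕ} {S : Type*}
    (g : EuclideanSpace ℝ (Fin n) → S → EuclideanSpace ℝ (Fin n)) (L a σ R β : ℝ) (N₀ τ : ℕ)
    (s : ℕ → ℕ → ℕ → S) (x₀ : EuclideanSpace ℝ (Fin n)) : EuclideanSpace ℝ (Fin n) :=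
  restartedSSTM g L a N₀ (clipParam R β N₀ τ) (batchSize L a σ R β N₀ τ) s x₀ τ

end

end ClippedSSTM

open ClippedSSTM

namespace ClippedSSTM

section Deterministic

variable {n : ℕ}

/-! ### Smooth and strongly convex functions -/

/-! The proof follows the potential `V_k = ‖z_k - x⋆‖² + 2 A_k (f(y_k) - f(x⋆))` of the accelerated
method. With exact gradients it would not increase; with clipped estimates its increment is at most
`2α⟨θ, x⋆ - z + αG⟩ + 2α²‖θ‖²`, where `G` is the gradient at the query point and `θ` the error of
the clipped estimate (`potential_advance_le`).

Fix a run with `ρ² = 5 R² / 2^t` and write `l` for the logarithmic term. While `V_k ≤ ρ²`, the bound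
`576 l² ≤ a` keeps `G` below half the clipping level (`alpha_mul_norm_gradient_le`). Clipping then
makes the increment, multiplied by `s = 2l/ρ²`, at most 1 in absolute value, so its exponential is
bounded by a quadratic polynomial in the unclipped error `v - G` (`exp_increment_le`). The linear
term has mean zero and the quadratic one needs only the variance, so no light tails are required:
each step multiplies the exponential moment by at most `exp(l/(2N))`. A Ville-type argument, stopped
when `V` exceeds `ρ²`, gives failure probability at most `exp(-l)` for a run that starts with `V_0 ≤
ρ²/5` (`measure_potential_gt_le`).

If `V_N ≤ ρ²`, then `A_N ≥ 10/μ` halves the bound on the optimality gap, and strong convexity turns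
the new gap into the starting radius of the next run. A union bound over the `τ` runs costs `τ
exp(-l) = β/(4N₀) ≤ β`. For the complexity, `a` is of order `l²`, so `N₀` is of order `l √(L/μ)`,
and the implicit inequality for `l` is solved using `log l ≤ l/2`. -/

lemma IsSmooth.le_quadratic {L : ℝ} {f : EuclideanSpace ℝ (Fin n) → ℝ} (hf : IsSmooth L f)
    (x y : EuclideanSpace ℝ (Fin n)) :
    f x ≤ f y + inner ℝ (∇ f y) (x - y) + L / 2 * ‖x - y‖ ^ 2 := by
  set d := x - y with hd
  -- The claim is `φ 1 ≤ φ 0`; the Lipschitz bound on the gradient makes `φ' ≤ 0` on `[0, ∞)`.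
  set φ : ℝ → ℝ := fun t => f (y + t • d) - t * inner ℝ (∇ f y) d - L / 2 * t ^ 2 * ‖d‖ ^ 2
    with hφ
  have hder : ∀ t : ℝ, HasDerivAt φ
      (inner ℝ (∇ f (y + t • d)) d - inner ℝ (∇ f y) d - L * t * ‖d‖ ^ 2) t := by
    intro t
    have h1 : HasDerivAt (fun t : ℝ => y + t • d) d t := by
      simpa using ((hasDerivAt_id t).smul_const d).const_add y
    have h2 := (hf.1 (y + t • d)).hasFDerivAt.comp_hasDerivAt t h1
    rw [← inner_gradient_left] at h2
    have h3 : HasDerivAt (fun t : ℝ => t * inner ℝ (∇ f y) d) (inner ℝ (∇ f y) d) t := by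
      simpa using (hasDerivAt_id t).mul_const (inner ℝ (∇ f y) d)
    have h4 : HasDerivAt (fun t : ℝ => L / 2 * t ^ 2 * ‖d‖ ^ 2) (L * t * ‖d‖ ^ 2) t := by
      refine (((hasDerivAt_pow 2 t).const_mul (L / 2)).mul_const (‖d‖ ^ 2)).congr_deriv ?_
      push_cast
      ring
    exact (h2.sub h3).sub h4
  have hanti : AntitoneOn φ (Set.Ici 0) := by
    refine antitoneOn_of_deriv_nonpos (convex_Ici 0)
      (fun t _ => (hder t).continuousAt.continuousWithinAt)
      (fun t _ => (hder t).differentiableAt.differentiableWithinAt) fun t ht => ?_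
    rw [(hder t).deriv, ← inner_sub_left]
    rw [interior_Ici] at ht
    have h1 := real_inner_le_norm (∇ f (y + t • d) - ∇ f y) d
    have h2 := hf.2 (y + t • d) y
    rw [add_sub_cancel_left, norm_smul, Real.norm_eq_abs, abs_of_pos ht] at h2
    nlinarith [mul_le_mul_of_nonneg_right h2 (norm_nonneg d)]
  have h := hanti (Set.mem_Ici.2 le_rfl) (Set.mem_Ici.2 zero_le_one) zero_le_one
  simp only [hφ, one_smul, zero_smul, hd, add_sub_cancel] at h
  simp only [add_zero] at h
  linarith

/-- A gradient step of length `1/L` lowers `f` by at least `‖∇ f x‖² / (2L)`, and cannot go below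
the minimum. -/
lemma IsSmooth.norm_gradient_sq_le {L : ℝ} (hL : 0 < L) {f : EuclideanSpace ℝ (Fin n) → ℝ}
    (hf : IsSmooth L f) {xs : EuclideanSpace ℝ (Fin n)} (hxs : ∀ x, f xs ≤ f x)
    (x : EuclideanSpace ℝ (Fin n)) : ‖∇ f x‖ ^ 2 ≤ 2 * L * (f x - f xs) := by
  have h := (hxs _).trans (hf.le_quadratic (x - L⁻¹ • ∇ f x) x)
  rw [sub_sub_cancel_left, inner_neg_right, inner_smul_right, real_inner_self_eq_norm_sq,
    norm_neg, norm_smul, Real.norm_eq_abs, abs_of_pos (inv_pos.2 hL)] at h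
  have h2 : L / 2 * (L⁻¹ * ‖∇ f x‖) ^ 2 = L⁻¹ * ‖∇ f x‖ ^ 2 / 2 := by
    field_simp
  rw [h2] at h
  have h3 : L⁻¹ * ‖∇ f x‖ ^ 2 ≤ 2 * (f x - f xs) := by linarith
  have h4 := mul_le_mul_of_nonneg_left h3 hL.le
  rw [mul_inv_cancel_left₀ hL.ne'] at h4
  linarith

lemma IsSmooth.gradient_minimizer {L : ℝ} (hL : 0 < L) {f : EuclideanSpace ℝ (Fin n) → ℝ}
    (hf : IsSmooth L f) {xs : EuclideanSpace ℝ (Fin n)} (hxs : ∀ x, f xs ≤ f x) :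
    ∇ f xs = 0 := by
  have h := hf.norm_gradient_sq_le hL hxs xs
  rw [sub_self, mul_zero] at h
  exact norm_eq_zero.1 (pow_eq_zero_iff two_ne_zero |>.1 (le_antisymm h (sq_nonneg _)))

lemma IsStronglyConvex.norm_sub_sq_le {μ L : ℝ} (hμ : 0 < μ) (hL : 0 < L)
    {f : EuclideanSpace ℝ (Fin n) → ℝ} (hc : IsStronglyConvex μ f) (hf : IsSmooth L f)
    {xs : EuclideanSpace ℝ (Fin n)} (hxs : ∀ x, f xs ≤ f x) (x : EuclideanSpace ℝ (Fin n)) :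
    ‖x - xs‖ ^ 2 ≤ 2 * (f x - f xs) / μ := by
  have h := hc.2 x xs
  rw [hf.gradient_minimizer hL hxs, inner_zero_left] at h
  rw [le_div_iff₀ hμ]
  linarith

lemma IsStronglyConvex.add_inner_le {μ : ℝ} (hμ : 0 < μ) {f : EuclideanSpace ℝ (Fin n) → ℝ}
    (hc : IsStronglyConvex μ f) (x y : EuclideanSpace ℝ (Fin n)) :
    f y + inner ℝ (∇ f y) (x - y) ≤ f x := by
  have h := hc.2 x y
  nlinarith [mul_nonneg hμ.le (sq_nonneg ‖x - y‖)]

/-- A function with two distinct points cannot be more strongly convex than it is smooth. -/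
lemma IsStronglyConvex.le_of_isSmooth {μ L : ℝ} {f : EuclideanSpace ℝ (Fin n) → ℝ}
    (hc : IsStronglyConvex μ f) (hf : IsSmooth L f) {x y : EuclideanSpace ℝ (Fin n)}
    (hxy : x ≠ y) : μ ≤ L := by
  have h1 := hc.2 x y
  have h2 := hf.le_quadratic x y
  have h3 : 0 < ‖x - y‖ ^ 2 := by
    have := norm_pos_iff.2 (sub_ne_zero.2 hxy)
    positivity
  by_contra! h
  nlinarith

/-! ### Clipping -/

lemma norm_clip_le (v : EuclideanSpace ℝ (Fin n)) {lam : ℝ} (hl : 0 ≤ lam) :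
    ‖clip v lam‖ ≤ lam := by
  rcases eq_or_ne v 0 with rfl | hv
  · simpa [clip] using hl
  have hv' := norm_pos_iff.2 hv
  rw [clip, norm_smul, Real.norm_eq_abs, abs_of_nonneg (le_min zero_le_one (by positivity))]
  calc min 1 (lam / ‖v‖) * ‖v‖ ≤ lam / ‖v‖ * ‖v‖ := by gcongr; exact min_le_right _ _
    _ = lam := div_mul_cancel₀ _ hv'.ne'

lemma clip_of_norm_le {v : EuclideanSpace ℝ (Fin n)} {lam : ℝ} (h : ‖v‖ ≤ lam) :
    clip v lam = v := by
  rcases eq_or_ne v 0 with rfl | hv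
  · simp [clip]
  rw [clip, min_eq_left ((one_le_div (norm_pos_iff.2 hv)).2 h), one_smul]

lemma norm_clip_sub_of_lt {v : EuclideanSpace ℝ (Fin n)} {lam : ℝ} (hl : 0 ≤ lam)
    (h : lam < ‖v‖) : ‖clip v lam - v‖ = ‖v‖ - lam := by
  have hv : 0 < ‖v‖ := hl.trans_lt h
  have h1 : lam / ‖v‖ ≤ 1 := (div_le_one hv).2 h.le
  have h2 : clip v lam - v = -((1 - lam / ‖v‖) • v) := by
    rw [clip, min_eq_right h1, sub_smul, one_smul, neg_sub]
  rw [h2, norm_neg, norm_smul, Real.norm_eq_abs, abs_of_nonneg (by linarith), sub_mul, one_mul,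
    div_mul_cancel₀ _ hv.ne']

/-- The clipping error is quadratic in the distance to a point of norm at most `lam / 2`. -/
lemma norm_clip_sub_self_le {v w : EuclideanSpace ℝ (Fin n)} {lam : ℝ} (hl : 0 < lam)
    (hw : ‖w‖ ≤ lam / 2) : ‖clip v lam - v‖ ≤ ‖v - w‖ ^ 2 / (2 * lam) := by
  rcases le_or_gt ‖v‖ lam with h | h
  · rw [clip_of_norm_le h, sub_self, norm_zero]
    positivity
  · rw [norm_clip_sub_of_lt hl.le h, le_div_iff₀ (by positivity)]
    -- With `d = ‖v - w‖`, `‖v‖ ≤ d + lam/2` gives `2 lam (‖v‖ - lam) ≤ 2 lam d - lam² ≤ d²`.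
    have := norm_sub_norm_le v w
    nlinarith [sq_nonneg (‖v - w‖ - lam)]

/-- When clipping is active, `‖v - w‖ ≥ lam/2`, whereas both clipped vector and `w` together have
norm at most `3 lam / 2`. -/
lemma norm_clip_sub_le {v w : EuclideanSpace ℝ (Fin n)} {lam : ℝ} (hl : 0 < lam)
    (hw : ‖w‖ ≤ lam / 2) : ‖clip v lam - w‖ ≤ 3 * ‖v - w‖ := by
  rcases le_or_gt ‖v‖ lam with h | h
  · rw [clip_of_norm_le h]
    linarith [norm_nonneg (v - w)]
  · have h1 := norm_sub_norm_le v w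
    have h2 := norm_sub_le (clip v lam) w
    have h3 := norm_clip_le v hl.le
    linarith

lemma clip_zero_right (v : EuclideanSpace ℝ (Fin n)) : clip v 0 = 0 := by
  simp [clip]

/-! ### The stepsizes -/

lemma alpha_succ (a L : ℝ) (k : ℕ) : alpha a L (k + 1) = ((k : ℝ) + 2) / (2 * a * L) := rfl

lemma alpha_succ_pos {a L : ℝ} (ha : 0 < a) (hL : 0 < L) (k : ℕ) : 0 < alpha a L (k + 1) := by
  rw [alpha_succ]
  positivity

lemma bigA_eq {a L : ℝ} (ha : 0 < a) (hL : 0 < L) (k : ℕ) :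
    bigA a L k = k * (k + 3) / (4 * a * L) := by
  induction k with
  | zero => simp [bigA]
  | succ k ih =>
    rw [bigA, ih, alpha_succ]
    push_cast
    field_simp
    ring

lemma bigA_nonneg {a L : ℝ} (ha : 0 < a) (hL : 0 < L) (k : ℕ) : 0 ≤ bigA a L k := by
  rw [bigA_eq ha hL]
  positivity

lemma bigA_succ_pos {a L : ℝ} (ha : 0 < a) (hL : 0 < L) (k : ℕ) : 0 < bigA a L (k + 1) := by
  rw [bigA_eq ha hL]
  positivity

/-- The stepsize condition behind acceleration; it amounts to `(k+2)² ≤ (k+1)(k+4)`. -/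
lemma mul_alpha_sq_le_bigA {a L : ℝ} (ha : 0 < a) (hL : 0 < L) (k : ℕ) :
    a * L * alpha a L (k + 1) ^ 2 ≤ bigA a L (k + 1) := by
  rw [bigA_eq ha hL, alpha_succ]
  have h : a * L * (((k : ℝ) + 2) / (2 * a * L)) ^ 2 = ((k : ℝ) + 2) ^ 2 / (4 * a * L) := by
    field_simp
    ring
  rw [h]
  push_cast
  gcongr
  nlinarith [(k.cast_nonneg : (0 : ℝ) ≤ k)]

/-! ### One iteration of clipped-SSTM -/

noncomputable section

/-- The point at which iteration `k` of clipped-SSTM evaluates the stochastic gradient. -/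
def queryPoint (a L : ℝ) (k : ℕ) (p : EuclideanSpace ℝ (Fin n) × EuclideanSpace ℝ (Fin n)) :
    EuclideanSpace ℝ (Fin n) :=
  (bigA a L (k + 1))⁻¹ • (bigA a L k • p.1 + alpha a L (k + 1) • p.2)

/-- Iteration `k` of clipped-SSTM with the gradient estimate `v`. -/
def advance (a L B : ℝ) (k : ℕ) (p : EuclideanSpace ℝ (Fin n) × EuclideanSpace ℝ (Fin n))
    (v : EuclideanSpace ℝ (Fin n)) : EuclideanSpace ℝ (Fin n) × EuclideanSpace ℝ (Fin n) :=
  (queryPoint a L k (p.1, p.2 - alpha a L (k + 1) • clip v (B / alpha a L (k + 1))),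
    p.2 - alpha a L (k + 1) • clip v (B / alpha a L (k + 1)))

/-- The potential `‖z - x⋆‖² + 2 A_k (f y - f x⋆)` of clipped-SSTM. -/
def potential (a L : ℝ) (f : EuclideanSpace ℝ (Fin n) → ℝ) (xs : EuclideanSpace ℝ (Fin n)) (k : ℕ)
    (p : EuclideanSpace ℝ (Fin n) × EuclideanSpace ℝ (Fin n)) : ℝ :=
  ‖p.2 - xs‖ ^ 2 + 2 * bigA a L k * (f p.1 - f xs)

end

lemma sstm_succ {S : Type*} (g : EuclideanSpace ℝ (Fin n) → S → EuclideanSpace ℝ (Fin n))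
    (L a B : ℝ) (m : ℕ → ℕ) (s : ℕ → ℕ → S) (x₀ : EuclideanSpace ℝ (Fin n)) (k : ℕ) :
    sstm g L a B m s x₀ (k + 1) = advance a L B k (sstm g L a B m s x₀ k)
      (miniBatch g (m k) (s k) (queryPoint a L k (sstm g L a B m s x₀ k))) := rfl

variable {μ L a : ℝ} {f : EuclideanSpace ℝ (Fin n) → ℝ} {xs : EuclideanSpace ℝ (Fin n)}

lemma bigA_smul_queryPoint (ha : 0 < a) (hL : 0 < L) (k : ℕ)
    (p : EuclideanSpace ℝ (Fin n) × EuclideanSpace ℝ (Fin n)) :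
    bigA a L (k + 1) • queryPoint a L k p = bigA a L k • p.1 + alpha a L (k + 1) • p.2 := by
  rw [queryPoint, smul_inv_smul₀ (bigA_succ_pos ha hL k).ne']

/-- Add the gradient inequalities at `x` towards `y` and towards `x⋆` with weights `A_k` and `α`. As
`A_{k+1} x = A_k y + α z`, the linear terms collapse to one in `z - x⋆`. -/
lemma bigA_mul_queryPoint_le (hμ : 0 < μ) (ha : 0 < a) (hL : 0 < L)
    (hc : IsStronglyConvex μ f) (k : ℕ)
    (p : EuclideanSpace ℝ (Fin n) × EuclideanSpace ℝ (Fin n)) :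
    bigA a L (k + 1) * (f (queryPoint a L k p) - f xs) ≤
      bigA a L k * (f p.1 - f xs) +
        alpha a L (k + 1) * inner ℝ (∇ f (queryPoint a L k p)) (p.2 - xs) := by
  set x := queryPoint a L k p with hx
  have h1 := mul_le_mul_of_nonneg_left (hc.add_inner_le hμ p.1 x) (bigA_nonneg ha hL k)
  have h2 := mul_le_mul_of_nonneg_left (hc.add_inner_le hμ xs x) (alpha_succ_pos ha hL k).le
  have h3 : bigA a L (k + 1) = bigA a L k + alpha a L (k + 1) := rfl
  have h4 : bigA a L k • (p.1 - x) + alpha a L (k + 1) • (xs - x) =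
      alpha a L (k + 1) • (xs - p.2) := by
    have := bigA_smul_queryPoint ha hL k p
    rw [← hx, h3, add_smul] at this
    rw [smul_sub, smul_sub, smul_sub,
      show bigA a L k • p.1 = bigA a L k • x + alpha a L (k + 1) • x - alpha a L (k + 1) • p.2 by
        rw [this]; abel]
    abel
  have h5 := congrArg (fun v => inner ℝ (∇ f x) v) h4
  simp only [inner_add_right, inner_smul_right] at h5
  rw [← neg_sub p.2 xs, inner_neg_right] at h5
  rw [h3]
  nlinarith

/-- The change of the potential in one iteration. -/
lemma potential_advance_le (hμ : 0 < μ) (ha : 1 ≤ a) (hL : 0 < L) (hc : IsStronglyConvex μ f)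
    (hf : IsSmooth L f) (B : ℝ) (k : ℕ)
    (p : EuclideanSpace ℝ (Fin n) × EuclideanSpace ℝ (Fin n)) (v : EuclideanSpace ℝ (Fin n)) :
    potential a L f xs (k + 1) (advance a L B k p v) ≤ potential a L f xs k p +
      2 * alpha a L (k + 1) *
        inner ℝ (clip v (B / alpha a L (k + 1)) - ∇ f (queryPoint a L k p))
          (xs - p.2 + alpha a L (k + 1) • ∇ f (queryPoint a L k p)) +
      2 * alpha a L (k + 1) ^ 2 *
        ‖clip v (B / alpha a L (k + 1)) - ∇ f (queryPoint a L k p)‖ ^ 2 := by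
  have ha0 : 0 < a := by linarith
  have h1 := bigA_mul_queryPoint_le (xs := xs) hμ ha0 hL hc k p
  have hA := bigA_succ_pos ha0 hL k
  have hLA : L * alpha a L (k + 1) ^ 2 ≤ bigA a L (k + 1) :=
    le_trans (by nlinarith [mul_nonneg hL.le (sq_nonneg (alpha a L (k + 1)))])
      (mul_alpha_sq_le_bigA ha0 hL k)
  simp only [potential, advance]
  set A' := bigA a L (k + 1)
  set α := alpha a L (k + 1)
  set x := queryPoint a L k p with hx
  set G := ∇ f x
  set c := clip v (B / α)
  set y' := queryPoint a L k (p.1, p.2 - α • c) with hy'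
  have hyx : y' - x = -((α * A'⁻¹) • α • c) := by
    change A'⁻¹ • (bigA a L k • p.1 + α • (p.2 - α • c)) -
      A'⁻¹ • (bigA a L k • p.1 + α • p.2) = _
    module
  have h2 := hf.le_quadratic y' x
  rw [hyx, inner_neg_right, norm_neg, smul_smul, inner_smul_right, norm_smul, mul_pow,
    Real.norm_eq_abs, sq_abs] at h2
  -- Smoothness along `y' - x = -(α²/A') c`; the quadratic term is absorbed by `L α² ≤ A'`.
  have h3 : A' * f y' ≤ A' * f x - α ^ 2 * inner ℝ G c + α ^ 2 * ‖c‖ ^ 2 / 2 := by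
    have h4 := mul_le_mul_of_nonneg_left h2 hA.le
    have h5 : A' * (f x + -(α * A'⁻¹ * α * inner ℝ G c) +
        L / 2 * ((α * A'⁻¹ * α) ^ 2 * ‖c‖ ^ 2)) =
        A' * f x - α ^ 2 * inner ℝ G c + L * α ^ 2 / A' * (α ^ 2 * ‖c‖ ^ 2 / 2) := by
      field_simp
      ring
    have h6 : L * α ^ 2 / A' ≤ 1 := (div_le_one hA).2 hLA
    have h7 := mul_le_mul_of_nonneg_right h6 (by positivity : 0 ≤ α ^ 2 * ‖c‖ ^ 2 / 2)
    rw [h5] at h4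
    linarith
  have h8 : ‖p.2 - α • c - xs‖ ^ 2 =
      ‖p.2 - xs‖ ^ 2 - 2 * α * inner ℝ c (p.2 - xs) + α ^ 2 * ‖c‖ ^ 2 := by
    rw [show p.2 - α • c - xs = (p.2 - xs) - α • c by abel, norm_sub_sq_real, inner_smul_right,
      norm_smul, mul_pow, Real.norm_eq_abs, sq_abs, real_inner_comm]
    ring
  have h9 : inner ℝ (c - G) (xs - p.2 + α • G) =
      inner ℝ G (p.2 - xs) - inner ℝ c (p.2 - xs) + α * (inner ℝ G c - ‖G‖ ^ 2) := by
    rw [← neg_sub p.2 xs, inner_add_right, inner_neg_right, inner_smul_right, inner_sub_left,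
      inner_sub_left, real_inner_self_eq_norm_sq, real_inner_comm c G]
    ring
  -- The rest is an identity: `⟨c, c - G⟩ = ⟨c - G, G⟩ + ‖c - G‖²`, which is where the summand `α •
  -- G` in the inner product comes from.
  rw [h8, h9, norm_sub_sq_real c G, real_inner_comm G c]
  nlinarith

/-- The gradients met by clipped-SSTM are short as long as the potential is small. -/
lemma alpha_mul_norm_gradient_le {l ρ : ℝ} (hμ : 0 < μ) (hL : 0 < L)
    (hc : IsStronglyConvex μ f) (hf : IsSmooth L f) (hxs : ∀ x, f xs ≤ f x) (hl : 2 ≤ l)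
    (hρ : 0 < ρ) (ha : 576 * l ^ 2 ≤ a) (k : ℕ)
    (p : EuclideanSpace ℝ (Fin n) × EuclideanSpace ℝ (Fin n))
    (hp : potential a L f xs k p ≤ ρ ^ 2) :
    alpha a L (k + 1) * ‖∇ f (queryPoint a L k p)‖ ≤ ρ / (16 * l) := by
  have ha0 : 0 < a := by nlinarith
  have h1 := bigA_mul_queryPoint_le (xs := xs) hμ ha0 hL hc k p
  have h2 := hf.norm_gradient_sq_le hL hxs (queryPoint a L k p)
  have h3 := mul_alpha_sq_le_bigA ha0 hL k
  have hα := alpha_succ_pos ha0 hL k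
  have hA := bigA_nonneg ha0 hL k
  simp only [potential] at hp
  set A' := bigA a L (k + 1)
  set α := alpha a L (k + 1)
  set x := queryPoint a L k p
  have hy : 0 ≤ bigA a L k * (f p.1 - f xs) := mul_nonneg hA (by linarith [hxs p.1])
  have hz : ‖p.2 - xs‖ ≤ ρ := by
    refine abs_le_of_sq_le_sq' ?_ hρ.le |>.2
    linarith
  have h4 : inner ℝ (∇ f x) (p.2 - xs) ≤ ‖∇ f x‖ * ρ :=
    (real_inner_le_norm _ _).trans (by gcongr)
  have h5 : 2 * bigA a L k * (f p.1 - f xs) ≤ ρ ^ 2 := by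
    linarith [sq_nonneg ‖p.2 - xs‖]
  set u := α * ‖∇ f x‖ with hu
  have hu0 : 0 ≤ u := by positivity
  -- Combines `a L α² ≤ A'`, `‖∇ f x‖² ≤ 2L (f x - f xs)` and the bound on `A' (f x - f xs)`.
  have h6 : a * u ^ 2 ≤ ρ ^ 2 + 2 * (u * ρ) := by
    have e1 : a * L * α ^ 2 * ‖∇ f x‖ ^ 2 ≤ A' * (2 * L * (f x - f xs)) := by
      have : 0 ≤ a * L * α ^ 2 := by positivity
      exact mul_le_mul h3 h2 (sq_nonneg _) (this.trans h3)
    have e2 := mul_le_mul_of_nonneg_left h4 hα.le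
    have e3 : L * (a * u ^ 2) ≤ L * (ρ ^ 2 + 2 * (u * ρ)) := by
      have e4 : 2 * A' * (f x - f xs) ≤ ρ ^ 2 + 2 * (u * ρ) := by rw [hu]; linarith
      have e5 := mul_le_mul_of_nonneg_left e4 hL.le
      rw [hu] at e5 ⊢
      linarith
    exact le_of_mul_le_mul_left e3 hL
  rw [le_div_iff₀ (by positivity)]
  by_contra! h
  -- If `ρ < 16 l u`, the right side of `h6` is at most `(256 l² + 32 l) u² ≤ 272 l² u²` for `l ≥
  -- 2`, contradicting `576 l² ≤ a`.
  have h7 : ρ ^ 2 + 2 * (u * ρ) ≤ 272 * l ^ 2 * u ^ 2 := by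
    have e1 : 0 < u * (16 * l) := hρ.trans h
    have e2 : ρ ^ 2 ≤ (u * (16 * l)) ^ 2 := by gcongr
    have e3 : u * ρ ≤ u * (u * (16 * l)) := by gcongr
    nlinarith [mul_nonneg (sq_nonneg u) (by nlinarith : (0 : ℝ) ≤ l * (l - 2))]
  have hu1 : 0 < u := by
    by_contra! h0
    nlinarith
  nlinarith [mul_le_mul_of_nonneg_right ha (sq_nonneg u), mul_pos (by positivity : 0 < l ^ 2)
    (by positivity : 0 < u ^ 2)]

/-- The exponential of the increment of the potential is dominated by a quadratic polynomial in
the error of the gradient estimate, without constant bias. -/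
lemma exp_increment_le {l ρ α : ℝ} (hl : 2 ≤ l) (hρ : 0 < ρ) (hα : 0 < α)
    {G w v : EuclideanSpace ℝ (Fin n)} (hG : α * ‖G‖ ≤ ρ / (16 * l)) (hw : ‖w‖ ≤ ρ) :
    Real.exp (2 * l / ρ ^ 2 * (2 * α * inner ℝ (clip v (ρ / (8 * l) / α) - G) (w + α • G) +
        2 * α ^ 2 * ‖clip v (ρ / (8 * l) / α) - G‖ ^ 2)) ≤
      1 + 4 * l * α / ρ ^ 2 * inner ℝ (v - G) (w + α • G) +
        220 * l ^ 2 * α ^ 2 / ρ ^ 2 * ‖v - G‖ ^ 2 := by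
  have hl0 : 0 < l := by linarith
  set lam := ρ / (8 * l) / α with hlam
  have hlam0 : 0 < lam := by positivity
  have hαlam : α * lam = ρ / (8 * l) := by rw [hlam]; field_simp
  have hG' : ‖G‖ ≤ lam / 2 := by
    refine le_of_mul_le_mul_left (hG.trans (le_of_eq ?_)) hα
    rw [mul_div_assoc', hαlam]
    field_simp
    norm_num
  set θ := clip v lam - G with hθ
  set η := w + α • G with hη
  set d := ‖v - G‖ with hd
  have hd0 : 0 ≤ d := norm_nonneg _
  set u := α * ‖θ‖ / ρ with hu
  have hu0 : 0 ≤ u := by positivity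
  have hηρ : ‖η‖ ≤ 33 / 32 * ρ := by
    have e1 : ‖α • G‖ ≤ ρ / 32 := by
      rw [norm_smul, Real.norm_eq_abs, abs_of_pos hα]
      refine hG.trans ?_
      gcongr
      linarith
    linarith [norm_add_le w (α • G)]
  have hu1 : u * l ≤ 3 / 16 := by
    have e1 : ‖θ‖ ≤ 3 / 2 * lam := by
      have := norm_sub_le (clip v lam) G
      linarith [norm_clip_le v hlam0.le]
    have e2 : α * ‖θ‖ ≤ 3 / 2 * (ρ / (8 * l)) := by
      rw [← hαlam]
      nlinarith
    rw [hu, div_mul_eq_mul_div, div_le_iff₀ hρ]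
    calc α * ‖θ‖ * l ≤ 3 / 2 * (ρ / (8 * l)) * l := by gcongr
      _ = 3 / 16 * ρ := by field_simp; norm_num
  have hu2 : u ≤ 3 * (α * d / ρ) := by
    rw [hu, mul_div_assoc']
    gcongr ?_ / ρ
    have := norm_clip_sub_le (v := v) hlam0 hG'
    nlinarith
  set X := 2 * l / ρ ^ 2 * (2 * α * inner ℝ θ η + 2 * α ^ 2 * ‖θ‖ ^ 2) with hX
  have hXabs : |X| ≤ 9 / 2 * (l * u) := by
    have e1 : |inner ℝ θ η| ≤ ‖θ‖ * (33 / 32 * ρ) :=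
      (abs_real_inner_le_norm _ _).trans (by gcongr)
    have e2 : |2 * α * inner ℝ θ η + 2 * α ^ 2 * ‖θ‖ ^ 2| ≤
        2 * α * (‖θ‖ * (33 / 32 * ρ)) + 2 * α ^ 2 * ‖θ‖ ^ 2 := by
      refine (abs_add_le _ _).trans ?_
      rw [abs_mul, abs_of_pos (by positivity : 0 < 2 * α),
        abs_of_nonneg (by positivity : 0 ≤ 2 * α ^ 2 * ‖θ‖ ^ 2)]
      gcongr
    rw [hX, abs_mul, abs_of_pos (by positivity : 0 < 2 * l / ρ ^ 2)]
    calc 2 * l / ρ ^ 2 * |2 * α * inner ℝ θ η + 2 * α ^ 2 * ‖θ‖ ^ 2|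
        ≤ 2 * l / ρ ^ 2 * (2 * α * (‖θ‖ * (33 / 32 * ρ)) + 2 * α ^ 2 * ‖θ‖ ^ 2) := by gcongr
      _ = 33 / 8 * (l * u) + 4 * u * (l * u) := by rw [hu]; field_simp; ring
      _ ≤ 9 / 2 * (l * u) := by nlinarith [mul_nonneg hl0.le hu0]
  -- `9/2 · 3/16 = 27/32`; the range in which `exp X ≤ 1 + X + X²` is available.
  have hX1 : |X| ≤ 1 := by linarith
  have hX2 : X ^ 2 ≤ 729 / 4 * l ^ 2 * (α * d / ρ) ^ 2 := by
    rw [← sq_abs]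
    calc |X| ^ 2 ≤ (9 / 2 * (l * (3 * (α * d / ρ)))) ^ 2 := by
          gcongr
          exact hXabs.trans (by gcongr)
      _ = _ := by ring
  -- The linear term keeps the unclipped error, which has mean zero; the clipping bias is already
  -- quadratic in `d` and joins the variance terms.
  have hX3 : X ≤ 4 * l * α / ρ ^ 2 * inner ℝ (v - G) η + 33 / 2 * l ^ 2 * (α * d / ρ) ^ 2 +
      36 * l * (α * d / ρ) ^ 2 := by
    have e1 : inner ℝ θ η = inner ℝ (v - G) η + inner ℝ (clip v lam - v) η := by
      rw [← inner_add_left, hθ]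
      congr 1
      abel
    have e2 : inner ℝ (clip v lam - v) η ≤ d ^ 2 / (2 * lam) * (33 / 32 * ρ) :=
      (real_inner_le_norm _ _).trans (by
        gcongr
        exact norm_clip_sub_self_le hlam0 hG')
    have e3 : X = 4 * l * α / ρ ^ 2 * inner ℝ θ η + 4 * l * u ^ 2 := by
      rw [hX, hu]; field_simp; ring
    have e4 : 4 * l * α / ρ ^ 2 * (d ^ 2 / (2 * lam) * (33 / 32 * ρ)) =
        33 / 2 * l ^ 2 * (α * d / ρ) ^ 2 := by
      rw [hlam]; field_simp; ring
    have e5 : 4 * l * u ^ 2 ≤ 4 * l * (3 * (α * d / ρ)) ^ 2 := by gcongr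
    have e6 : 4 * l * α / ρ ^ 2 * inner ℝ (clip v lam - v) η ≤
        4 * l * α / ρ ^ 2 * (d ^ 2 / (2 * lam) * (33 / 32 * ρ)) := by gcongr
    rw [e3, e1, mul_add]
    linarith
  have hexp : Real.exp X ≤ 1 + X + X ^ 2 := by
    have := (abs_le.1 (Real.abs_exp_sub_one_sub_id_le hX1)).2
    linarith
  have hfin : 220 * l ^ 2 * α ^ 2 / ρ ^ 2 * d ^ 2 = 220 * l ^ 2 * (α * d / ρ) ^ 2 := by
    field_simp
  rw [hfin]
  -- Since `36 l ≤ 18 l²`, the coefficients add up to `729/4 + 33/2 + 18 < 220`.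
  nlinarith [mul_nonneg (sq_nonneg (α * d / ρ)) (by nlinarith : (0 : ℝ) ≤ l * (l - 2)),
    mul_nonneg (sq_nonneg (α * d / ρ)) (sq_nonneg l)]

/-- Starting the potential at radius `ρ / √5`, a potential of `ρ ^ 2` after enough iterations
means that the optimality gap is halved. -/
lemma sub_le_of_potential_le {ρ : ℝ} {N : ℕ} (hμ : 0 < μ) (hL : 0 < L) (ha : 0 < a)
    (hN : √5 * √(8 * a * L / μ) ≤ N)
    (p : EuclideanSpace ℝ (Fin n) × EuclideanSpace ℝ (Fin n))
    (hxs : ∀ x, f xs ≤ f x)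
    (hp : potential a L f xs N p ≤ ρ ^ 2) : f p.1 - f xs ≤ μ * ρ ^ 2 / 20 := by
  have h1 : 40 * a * L / μ ≤ (N : ℝ) ^ 2 := by
    calc 40 * a * L / μ = (√5 * √(8 * a * L / μ)) ^ 2 := by
          rw [mul_pow, Real.sq_sqrt (by norm_num), Real.sq_sqrt (by positivity)]; ring
      _ ≤ (N : ℝ) ^ 2 := by gcongr
  -- This yields a gap of at most `μρ²/20`, half of the value `μρ²/10` attached to the start of the
  -- run.
  have h2 : 10 / μ ≤ bigA a L N := by
    rw [bigA_eq ha hL]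
    calc 10 / μ = 40 * a * L / μ / (4 * a * L) := by field_simp; norm_num
      _ ≤ (N : ℝ) * (N + 3) / (4 * a * L) := by
        gcongr
        nlinarith [(N.cast_nonneg : (0 : ℝ) ≤ N)]
  simp only [potential] at hp
  have h3 := mul_le_mul_of_nonneg_right h2 (by linarith [hxs p.1] : 0 ≤ f p.1 - f xs)
  have h4 : 10 / μ * (f p.1 - f xs) ≤ ρ ^ 2 / 2 := by linarith [sq_nonneg ‖p.2 - xs‖]
  have h5 := mul_le_mul_of_nonneg_left h4 hμ.le
  have h6 : μ * (10 / μ * (f p.1 - f xs)) = 10 * (f p.1 - f xs) := by field_simp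
  linarith

end Deterministic

/-! ### Moments of mini-batch gradients -/

section Moments

variable {Ω : Type*} [MeasurableSpace Ω] {Pr : Measure Ω}

/-- Variances of centred vectors add under pairwise independence: the inner products in the expanded
square have mean zero. -/
lemma integrable_integral_norm_sum_sq {ι E : Type*} [NormedAddCommGroup E] [InnerProductSpace ℝ E]
    [CompleteSpace E] [MeasurableSpace E] [BorelSpace E] {Y : ι → Ω → E}
    (hint : ∀ i, Integrable (Y i) Pr) (hsq : ∀ i, Integrable (fun ω => ‖Y i ω‖ ^ 2) Pr)
    (hzero : ∀ i, ∫ ω, Y i ω ∂Pr = 0) (hind : Pairwise fun i j => IndepFun (Y i) (Y j) Pr)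
    (s : Finset ι) :
    Integrable (fun ω => ‖∑ i ∈ s, Y i ω‖ ^ 2) Pr ∧
      ∫ ω, ‖∑ i ∈ s, Y i ω‖ ^ 2 ∂Pr = ∑ i ∈ s, ∫ ω, ‖Y i ω‖ ^ 2 ∂Pr := by
  classical
  induction s using Finset.induction_on with
  | empty => simp
  | insert j s hj ih =>
    have hinner : ∀ i ∈ s, Integrable (fun ω => inner ℝ (Y j ω) (Y i ω)) Pr ∧
        ∫ ω, inner ℝ (Y j ω) (Y i ω) ∂Pr = 0 := by
      intro i hi
      have hij : IndepFun (Y j) (Y i) Pr := hind fun h => hj (h ▸ hi)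
      refine ⟨hij.integrable_bilin (hint j) (hint i) (innerSL ℝ), ?_⟩
      have := hij.integral_bilin (hint j) (hint i) (innerSL ℝ)
      rw [hzero, hzero, map_zero] at this
      exact this
    have hcross : Integrable (fun ω => ∑ i ∈ s, inner ℝ (Y j ω) (Y i ω)) Pr :=
      integrable_finsetSum _ fun i hi => (hinner i hi).1
    have hexp : ∀ ω, ‖∑ i ∈ insert j s, Y i ω‖ ^ 2 =
        ‖Y j ω‖ ^ 2 + 2 * ∑ i ∈ s, inner ℝ (Y j ω) (Y i ω) + ‖∑ i ∈ s, Y i ω‖ ^ 2 := by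
      intro ω
      rw [sum_insert hj, norm_add_sq_real, inner_sum]
    have hsum : Integrable (fun ω => ‖Y j ω‖ ^ 2 + 2 * ∑ i ∈ s, inner ℝ (Y j ω) (Y i ω)) Pr :=
      (hsq j).add (hcross.const_mul 2)
    simp only [hexp]
    refine ⟨hsum.add ih.1, ?_⟩
    rw [integral_add hsum ih.1, integral_add (hsq j) (hcross.const_mul 2), integral_const_mul,
      integral_finsetSum _ fun i hi => (hinner i hi).1, sum_eq_zero fun i hi => (hinner i hi).2,
      ih.2, sum_insert hj]
    ring

variable {n : ℕ} {S : Type*} {σ : ℝ}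
  {f : EuclideanSpace ℝ (Fin n) → ℝ} {g : EuclideanSpace ℝ (Fin n) → S → EuclideanSpace ℝ (Fin n)}
  {ζ : ℕ → Ω → S}

lemma miniBatch_sub_eq {m : ℕ} (hm : 1 ≤ m) (s : ℕ → S) (x : EuclideanSpace ℝ (Fin n)) :
    miniBatch g m s x - ∇ f x = (m : ℝ)⁻¹ • ∑ i ∈ range m, (g x (s i) - ∇ f x) := by
  have hm0 : (m : ℝ) ≠ 0 := by positivity
  rw [miniBatch, sum_sub_distrib, smul_sub, sum_const, card_range, ← Nat.cast_smul_eq_nsmul ℝ,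
    inv_smul_smul₀ hm0]

variable [MeasurableSpace S] {P : Measure S}

/-- A mini-batch gradient is unbiased, and its variance decreases linearly in the batch size. -/
lemma IsStochasticGradient.miniBatch_moments (hg : IsStochasticGradient P σ f g)
    (hζ : ∀ i, Measurable (ζ i)) (hlaw : ∀ i, Measure.map (ζ i) Pr = P)
    (hind : Pairwise fun i j => IndepFun (ζ i) (ζ j) Pr) [IsProbabilityMeasure Pr]
    {m : ℕ} (hm : 1 ≤ m)
    (x : EuclideanSpace ℝ (Fin n)) :
    Integrable (fun ω => miniBatch g m (fun i => ζ i ω) x - ∇ f x) Pr ∧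
      ∫ ω, (miniBatch g m (fun i => ζ i ω) x - ∇ f x) ∂Pr = 0 ∧
      Integrable (fun ω => ‖miniBatch g m (fun i => ζ i ω) x - ∇ f x‖ ^ 2) Pr ∧
      ∫ ω, ‖miniBatch g m (fun i => ζ i ω) x - ∇ f x‖ ^ 2 ∂Pr ≤ σ ^ 2 / m := by
  have hm0 : (0 : ℝ) < m := by positivity
  have hgx : Measurable (fun s => g x s - ∇ f x) :=
    (hg.measurable.comp measurable_prodMk_left).sub_const _
  have hYint : ∀ i, Integrable (fun ω => g x (ζ i ω) - ∇ f x) Pr := fun i => by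
    have h := hg.integrable x
    rw [← hlaw i] at h
    exact (h.comp_measurable (hζ i)).sub (integrable_const _)
  have hYsq : ∀ i, Integrable (fun ω => ‖g x (ζ i ω) - ∇ f x‖ ^ 2) Pr := fun i => by
    have h := hg.integrable_sq x
    rw [← hlaw i] at h
    exact h.comp_measurable (hζ i)
  have hYzero : ∀ i, ∫ ω, (g x (ζ i ω) - ∇ f x) ∂Pr = 0 := fun i => by
    have h : ∫ ω, g x (ζ i ω) ∂Pr = ∇ f x := by
      rw [← hg.unbiased x, ← hlaw i, integral_map (hζ i).aemeasurable]
      exact (hg.measurable.comp measurable_prodMk_left).aestronglyMeasurable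
    have hint := hg.integrable x
    rw [← hlaw i] at hint
    have hint' : Integrable (fun ω => g x (ζ i ω)) Pr := hint.comp_measurable (hζ i)
    rw [integral_sub hint' (integrable_const _), h]
    simp
  have hYvar : ∀ i, ∫ ω, ‖g x (ζ i ω) - ∇ f x‖ ^ 2 ∂Pr ≤ σ ^ 2 := fun i => by
    refine le_trans (le_of_eq ?_) (hg.variance_le x)
    rw [← hlaw i, integral_map (hζ i).aemeasurable]
    exact (hgx.norm.pow_const 2).aestronglyMeasurable
  have hYind : Pairwise fun i j => IndepFun (fun ω => g x (ζ i ω) - ∇ f x)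
      (fun ω => g x (ζ j ω) - ∇ f x) Pr := fun i j hij => (hind hij).comp hgx hgx
  obtain ⟨h1, h2⟩ := integrable_integral_norm_sum_sq hYint hYsq hYzero hYind (range m)
  simp only [miniBatch_sub_eq hm, norm_smul, mul_pow]
  refine ⟨(integrable_finsetSum _ fun i _ => hYint i).fun_smul _, ?_, h1.const_mul _, ?_⟩
  · rw [integral_smul, integral_finsetSum _ fun i _ => hYint i]
    simp [hYzero]
  · rw [integral_const_mul, h2, norm_inv, Real.norm_eq_abs, abs_of_pos hm0]
    calc ((m : ℝ)⁻¹) ^ 2 * ∑ i ∈ range m, ∫ ω, ‖g x (ζ i ω) - ∇ f x‖ ^ 2 ∂Pr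
        ≤ ((m : ℝ)⁻¹) ^ 2 * ∑ i ∈ range m, σ ^ 2 := by
          gcongr with i
          exact hYvar i
      _ = σ ^ 2 / m := by
          rw [sum_const, card_range, nsmul_eq_mul]
          field_simp

/-- One iteration increases the exponential moment of the potential only slightly. -/
lemma lintegral_exp_potential_advance_le {μ L a l ρ c : ℝ} {xs : EuclideanSpace ℝ (Fin n)}
    [IsProbabilityMeasure Pr] (hμ : 0 < μ)
    (hL : 0 < L) (hc : IsStronglyConvex μ f) (hf : IsSmooth L f) (hxs : ∀ x, f xs ≤ f x)
    (hg : IsStochasticGradient P σ f g)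
    (hζ : ∀ i, Measurable (ζ i)) (hlaw : ∀ i, Measure.map (ζ i) Pr = P)
    (hind : Pairwise fun i j => IndepFun (ζ i) (ζ j) Pr)
    (hl : 2 ≤ l) (hρ : 0 < ρ) (ha : 576 * l ^ 2 ≤ a) {m : ℕ} (hm : 1 ≤ m) (k : ℕ)
    (hcm : 220 * l ^ 2 * alpha a L (k + 1) ^ 2 / ρ ^ 2 * (σ ^ 2 / m) ≤ c)
    (p : EuclideanSpace ℝ (Fin n) × EuclideanSpace ℝ (Fin n))
    (hp : potential a L f xs k p ≤ ρ ^ 2) :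
    ∫⁻ ω, ENNReal.ofReal (Real.exp (2 * l / ρ ^ 2 * potential a L f xs (k + 1)
        (advance a L (ρ / (8 * l)) k p
          (miniBatch g m (fun i => ζ i ω) (queryPoint a L k p))))) ∂Pr ≤
      ENNReal.ofReal (Real.exp c) *
        ENNReal.ofReal (Real.exp (2 * l / ρ ^ 2 * potential a L f xs k p)) := by
  have ha1 : 1 ≤ a := by nlinarith
  have hα := alpha_succ_pos (by linarith : 0 < a) hL k
  obtain ⟨hD, hDzero, hDsq, hDvar⟩ := hg.miniBatch_moments hζ hlaw hind hm (queryPoint a L k p)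
  have hgrad := alpha_mul_norm_gradient_le hμ hL hc hf hxs hl hρ ha k p hp
  have hz : ‖xs - p.2‖ ≤ ρ := by
    rw [norm_sub_rev]
    refine abs_le_of_sq_le_sq' ?_ hρ.le |>.2
    have : 0 ≤ bigA a L k * (f p.1 - f xs) :=
      mul_nonneg (bigA_nonneg (by linarith) hL k) (by linarith [hxs p.1])
    simp only [potential] at hp
    linarith
  set D : Ω → EuclideanSpace ℝ (Fin n) := fun ω =>
    miniBatch g m (fun i => ζ i ω) (queryPoint a L k p) - ∇ f (queryPoint a L k p) with hDdef
  set α := alpha a L (k + 1)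
  set G := ∇ f (queryPoint a L k p)
  set η := xs - p.2 + α • G
  set Q : Ω → ℝ := fun ω => 1 + 4 * l * α / ρ ^ 2 * inner ℝ (D ω) η +
    220 * l ^ 2 * α ^ 2 / ρ ^ 2 * ‖D ω‖ ^ 2 with hQdef
  have hpt : ∀ ω, Real.exp (2 * l / ρ ^ 2 * potential a L f xs (k + 1)
        (advance a L (ρ / (8 * l)) k p
          (miniBatch g m (fun i => ζ i ω) (queryPoint a L k p)))) ≤
      Real.exp (2 * l / ρ ^ 2 * potential a L f xs k p) * Q ω := by
    intro ω
    have h1 := potential_advance_le (xs := xs) hμ ha1 hL hc hf (ρ / (8 * l)) k p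
      (miniBatch g m (fun i => ζ i ω) (queryPoint a L k p))
    have h2 := exp_increment_le hl hρ hα (v := miniBatch g m (fun i => ζ i ω)
      (queryPoint a L k p)) hgrad hz
    refine le_trans ?_ (mul_le_mul_of_nonneg_left h2 (Real.exp_pos _).le)
    rw [← Real.exp_add, ← mul_add]
    gcongr
    linarith
  -- `Q` dominates a positive quantity, so its Bochner integral can be exchanged for the Lebesgue
  -- one.
  have hQpos : ∀ ω, 0 ≤ Q ω := fun ω =>
    nonneg_of_mul_nonneg_right ((Real.exp_pos _).le.trans (hpt ω)) (Real.exp_pos _)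
  have hinner : Integrable (fun ω => inner ℝ (D ω) η) Pr := hD.inner_const η
  have hinner0 : ∫ ω, inner ℝ (D ω) η ∂Pr = 0 := by
    have h : ∫ ω, inner ℝ η (D ω) ∂Pr = inner ℝ η (∫ ω, D ω ∂Pr) := integral_inner hD η
    rw [hDzero, inner_zero_right] at h
    simpa only [real_inner_comm] using h
  have hlin : Integrable (fun ω => 1 + 4 * l * α / ρ ^ 2 * inner ℝ (D ω) η) Pr :=
    (integrable_const _).add (hinner.const_mul _)
  have hDsq' : Integrable (fun ω => ‖D ω‖ ^ 2) Pr := hDsq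
  have hQint : Integrable Q Pr := hlin.add (hDsq'.const_mul _)
  have hQle : ∫ ω, Q ω ∂Pr ≤ Real.exp c := by
    have h1 : ∫ ω, Q ω ∂Pr = 1 + 220 * l ^ 2 * α ^ 2 / ρ ^ 2 * ∫ ω, ‖D ω‖ ^ 2 ∂Pr := by
      rw [hQdef, integral_add hlin (hDsq'.const_mul _), integral_add (integrable_const _) (hinner.const_mul _), integral_const_mul,
        integral_const_mul, hinner0]
      simp
    have h2 : 220 * l ^ 2 * α ^ 2 / ρ ^ 2 * ∫ ω, ‖D ω‖ ^ 2 ∂Pr ≤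
        220 * l ^ 2 * α ^ 2 / ρ ^ 2 * (σ ^ 2 / m) := by gcongr
    rw [h1]
    linarith [Real.add_one_le_exp c]
  calc _ ≤ ∫⁻ ω, ENNReal.ofReal (Real.exp (2 * l / ρ ^ 2 * potential a L f xs k p)) *
        ENNReal.ofReal (Q ω) ∂Pr := by
        refine lintegral_mono fun ω => ?_
        rw [← ENNReal.ofReal_mul (Real.exp_pos _).le]
        exact ENNReal.ofReal_le_ofReal (hpt ω)
    _ = ENNReal.ofReal (Real.exp (2 * l / ρ ^ 2 * potential a L f xs k p)) *
        ENNReal.ofReal (∫ ω, Q ω ∂Pr) := by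
        rw [lintegral_const_mul' _ _ ENNReal.ofReal_ne_top,
          ofReal_integral_eq_lintegral_ofReal hQint (Filter.Eventually.of_forall hQpos)]
    _ ≤ _ := by
        rw [mul_comm]
        gcongr

end Moments

/-! ### A maximal inequality -/

section Maximal

variable {Ω : Type*} [MeasurableSpace Ω] {Pr : Measure Ω}

/-- A maximal inequality of Ville's type for a process whose exponential moments are controlled
only as long as the process stays below the level `M`. -/
lemma measure_gt_le_of_lintegral_exp_le [IsProbabilityMeasure Pr] {V : ℕ → Ω → ℝ} {s v₀ M c : ℝ}
    (hs : 0 ≤ s) {N : ℕ} (hV : ∀ k ≤ N, Measurable (V k))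
    (hstep : ∀ k < N,
      ∫⁻ ω in {ω | V 0 ω ≤ v₀ ∧ ∀ j ≤ k, V j ω ≤ M}, ENNReal.ofReal (Real.exp (s * V (k + 1) ω)) ∂Pr
        ≤ ENNReal.ofReal (Real.exp c) *
      ∫⁻ ω in {ω | V 0 ω ≤ v₀ ∧ ∀ j ≤ k, V j ω ≤ M}, ENNReal.ofReal (Real.exp (s * V k ω)) ∂Pr)
    (hc : 0 ≤ c) (hv₀ : v₀ ≤ M) :
    Pr {ω | V 0 ω ≤ v₀ ∧ M < V N ω} ≤ ENNReal.ofReal (Real.exp (s * v₀ - s * M + N * c)) := by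
  set D : ℕ → Set Ω := fun k => {ω | V 0 ω ≤ v₀ ∧ ∀ j ≤ k, V j ω ≤ M} with hD
  have hDmeas : ∀ k ≤ N, MeasurableSet (D k) := by
    intro k hk
    have : D k = {ω | V 0 ω ≤ v₀} ∩ ⋂ j ∈ Set.Iic k, {ω | V j ω ≤ M} := by
      ext ω; simp [hD]
    rw [this]
    exact (measurableSet_le (hV 0 (Nat.zero_le _)) measurable_const).inter
      (MeasurableSet.biInter (Set.to_countable _) fun j hj =>
        measurableSet_le (hV j (le_trans hj hk)) measurable_const)
  have hDanti : ∀ k, D (k + 1) ⊆ D k := fun k ω hω =>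
    ⟨hω.1, fun j hj => hω.2 j (hj.trans (Nat.le_succ k))⟩
  set e : ENNReal := ENNReal.ofReal (Real.exp (s * M)) with he
  -- Invariant: the exponential moment on the paths still below `M`, plus `exp (s M)` times the
  -- probability of having left by time `k`.
  have key : ∀ k ≤ N, ∫⁻ ω in D k, ENNReal.ofReal (Real.exp (s * V k ω)) ∂Pr + e * Pr (D 0 \ D k) ≤
      ENNReal.ofReal (Real.exp (s * v₀ + k * c)) := by
    intro k
    induction k with
    | zero =>
      intro _
      rw [Set.sdiff_self, measure_empty, mul_zero, add_zero]
      calc ∫⁻ ω in D 0, ENNReal.ofReal (Real.exp (s * V 0 ω)) ∂Pr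
          ≤ ∫⁻ ω in D 0, ENNReal.ofReal (Real.exp (s * v₀)) ∂Pr := by
            refine setLIntegral_mono' (hDmeas 0 (Nat.zero_le _)) fun ω hω => ?_
            have := hω.1
            gcongr
        _ ≤ ENNReal.ofReal (Real.exp (s * v₀)) := by
            rw [setLIntegral_const]
            exact mul_le_of_le_one_right' prob_le_one
        _ = _ := by simp
    | succ k ih =>
      intro hk
      have hk' : k ≤ N := (Nat.le_succ k).trans hk
      have h1 : e * Pr (D k \ D (k + 1)) ≤
          ∫⁻ ω in D k \ D (k + 1), ENNReal.ofReal (Real.exp (s * V (k + 1) ω)) ∂Pr := by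
        rw [← setLIntegral_const]
        refine setLIntegral_mono' ((hDmeas k hk').diff (hDmeas (k + 1) hk)) fun ω hω => ?_
        have h2 : M ≤ V (k + 1) ω := by
          by_contra! h
          refine hω.2 ⟨hω.1.1, fun j hj => ?_⟩
          rcases Nat.le_succ_iff.1 hj with hj | rfl
          · exact hω.1.2 j hj
          · exact h.le
        rw [he]
        gcongr
      have h3 : Pr (D 0 \ D (k + 1)) ≤ Pr (D 0 \ D k) + Pr (D k \ D (k + 1)) := by
        refine (measure_mono fun ω hω => ?_).trans (measure_union_le _ _)
        by_cases h : ω ∈ D k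
        · exact Or.inr ⟨h, hω.2⟩
        · exact Or.inl ⟨hω.1, h⟩
      have h4 : ∫⁻ ω in D (k + 1), ENNReal.ofReal (Real.exp (s * V (k + 1) ω)) ∂Pr +
          ∫⁻ ω in D k \ D (k + 1), ENNReal.ofReal (Real.exp (s * V (k + 1) ω)) ∂Pr =
          ∫⁻ ω in D k, ENNReal.ofReal (Real.exp (s * V (k + 1) ω)) ∂Pr := by
        rw [← lintegral_inter_add_sdiff _ (D k) (hDmeas (k + 1) hk),
          Set.inter_eq_self_of_subset_right (hDanti k)]
      -- `c ≥ 0` lets the part that has already left be multiplied by `exp c` too.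
      have hone : 1 ≤ ENNReal.ofReal (Real.exp c) :=
        ENNReal.one_le_ofReal.2 (Real.one_le_exp hc)
      calc ∫⁻ ω in D (k + 1), ENNReal.ofReal (Real.exp (s * V (k + 1) ω)) ∂Pr +
            e * Pr (D 0 \ D (k + 1))
          ≤ ∫⁻ ω in D (k + 1), ENNReal.ofReal (Real.exp (s * V (k + 1) ω)) ∂Pr +
            (e * Pr (D 0 \ D k) +
            ∫⁻ ω in D k \ D (k + 1), ENNReal.ofReal (Real.exp (s * V (k + 1) ω)) ∂Pr) := by
            gcongr
            exact (mul_le_mul_right h3 e).trans (by rw [mul_add]; gcongr)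
        _ = ∫⁻ ω in D k, ENNReal.ofReal (Real.exp (s * V (k + 1) ω)) ∂Pr + e * Pr (D 0 \ D k) := by
            rw [← h4]; ring
        _ ≤ ENNReal.ofReal (Real.exp c) * ∫⁻ ω in D k, ENNReal.ofReal (Real.exp (s * V k ω)) ∂Pr +
            ENNReal.ofReal (Real.exp c) * (e * Pr (D 0 \ D k)) := by
            exact add_le_add (hstep k hk) (le_mul_of_one_le_left' hone)
        _ ≤ ENNReal.ofReal (Real.exp c) * ENNReal.ofReal (Real.exp (s * v₀ + k * c)) := by
            rw [← mul_add]
            gcongr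
            exact ih hk'
        _ = _ := by
            rw [← ENNReal.ofReal_mul (Real.exp_pos _).le, ← Real.exp_add]
            congr 2
            push_cast
            ring
  have h5 : {ω | V 0 ω ≤ v₀ ∧ M < V N ω} ⊆ D 0 \ D N := fun ω hω =>
    ⟨⟨hω.1, fun j hj => by rw [Nat.le_zero.1 hj]; exact hω.1.trans hv₀⟩,
      fun h => absurd (h.2 N le_rfl) (not_le.2 hω.2)⟩
  have h6 : e * Pr {ω | V 0 ω ≤ v₀ ∧ M < V N ω} ≤ ENNReal.ofReal (Real.exp (s * v₀ + N * c)) :=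
    (mul_le_mul_right (measure_mono h5) e).trans (le_add_self.trans (key N le_rfl))
  have h7 : ENNReal.ofReal (Real.exp (-(s * M))) * e = 1 := by
    rw [he, ← ENNReal.ofReal_mul (Real.exp_pos _).le, ← Real.exp_add]
    simp
  calc Pr {ω | V 0 ω ≤ v₀ ∧ M < V N ω}
      = ENNReal.ofReal (Real.exp (-(s * M))) * (e * Pr {ω | V 0 ω ≤ v₀ ∧ M < V N ω}) := by
        rw [← mul_assoc, h7, one_mul]
    _ ≤ ENNReal.ofReal (Real.exp (-(s * M))) * ENNReal.ofReal (Real.exp (s * v₀ + N * c)) := by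
        gcongr
    _ = _ := by
        rw [← ENNReal.ofReal_mul (Real.exp_pos _).le, ← Real.exp_add]
        congr 2
        ring

/-- Conditioning on one of two independent variables. -/
lemma setLIntegral_comp_prod_of_indepFun [IsFiniteMeasure Pr] {A T : Type*} [MeasurableSpace A]
    [MeasurableSpace T] {U : Ω → A} {b : Ω → T} {D : Set Ω} (hD : MeasurableSet D)
    (hU : Measurable U) (hb : Measurable b)
    (hind : IndepFun (fun ω => (D.indicator (1 : Ω → ENNReal) ω, U ω)) b Pr)
    {G : A × T → ENNReal} (hG : Measurable G) :
    ∫⁻ ω in D, G (U ω, b ω) ∂Pr = ∫⁻ ω in D, ∫⁻ ω', G (U ω, b ω') ∂Pr ∂Pr := by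
  have hI : Measurable (D.indicator (1 : Ω → ENNReal)) := measurable_one.indicator hD
  have hmul : ∀ F : Ω → ENNReal, ∫⁻ ω in D, F ω ∂Pr =
      ∫⁻ ω, D.indicator (1 : Ω → ENNReal) ω * F ω ∂Pr := by
    intro F
    rw [← lintegral_indicator hD]
    congr 1
    ext ω
    by_cases h : ω ∈ D <;> simp [h]
  -- The indicator of `D` is carried as a coordinate next to `U`, which turns the restricted
  -- integral into one against a product law.
  have hH : Measurable (fun q : (ENNReal × A) × T => q.1.1 * G (q.1.2, q.2)) := by fun_prop
  have hWU : Measurable (fun ω => (D.indicator (1 : Ω → ENNReal) ω, U ω)) := hI.prodMk hU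
  rw [hmul, hmul]
  calc ∫⁻ ω, D.indicator (1 : Ω → ENNReal) ω * G (U ω, b ω) ∂Pr
      = ∫⁻ q, q.1.1 * G (q.1.2, q.2)
          ∂(Pr.map fun ω => ((D.indicator (1 : Ω → ENNReal) ω, U ω), b ω)) :=
        (lintegral_map hH (hWU.prodMk hb)).symm
    _ = ∫⁻ w, ∫⁻ t, w.1 * G (w.2, t) ∂(Pr.map b)
          ∂(Pr.map fun ω => (D.indicator (1 : Ω → ENNReal) ω, U ω)) := by
        rw [hind.map_prod_eq_prod_map_map hWU.aemeasurable hb.aemeasurable,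
          lintegral_prod _ hH.aemeasurable]
    _ = ∫⁻ ω, ∫⁻ t, D.indicator (1 : Ω → ENNReal) ω * G (U ω, t) ∂(Pr.map b) ∂Pr := by
        rw [lintegral_map hH.lintegral_prod_right' hWU]
    _ = _ := by
        refine lintegral_congr fun ω => ?_
        rw [lintegral_map (by fun_prop) hb, lintegral_const_mul _ (by fun_prop)]

end Maximal

/-- Covers `R = 0`, where the clipping level vanishes and the iterates never move. -/
lemma sstm_clip_zero {n : ℕ} {S : Type*}
    (g : EuclideanSpace ℝ (Fin n) → S → EuclideanSpace ℝ (Fin n)) (L a : ℝ) (m : ℕ → ℕ)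
    (s : ℕ → ℕ → S) (x₀ : EuclideanSpace ℝ (Fin n)) (ha : 0 < a) (hL : 0 < L) (k : ℕ) : sstm g L a 0 m s x₀ k = (x₀, x₀) := by
  induction k with
  | zero => rfl
  | succ k ih =>
    have hA := bigA_succ_pos ha hL k
    have h : bigA a L (k + 1) = bigA a L k + alpha a L (k + 1) := rfl
    have hq : queryPoint a L k (x₀, x₀) = x₀ := by
      rw [queryPoint, ← add_smul, ← h, inv_smul_smul₀ hA.ne']
    rw [sstm_succ, ih, advance]
    simp [clip_zero_right, hq]

/-! ### Measurability of the iterates -/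

section Measurability

variable {n : ℕ} {S Ω : Type*} [MeasurableSpace S]
  {g : EuclideanSpace ℝ (Fin n) → S → EuclideanSpace ℝ (Fin n)}

lemma measurable_clip (lam : ℝ) : Measurable fun v : EuclideanSpace ℝ (Fin n) => clip v lam := by
  unfold clip
  fun_prop

lemma measurable_queryPoint (a L : ℝ) (k : ℕ) :
    Measurable (queryPoint (n := n) a L k) := by
  unfold queryPoint
  fun_prop

lemma measurable_advance (a L B : ℝ) (k : ℕ) :
    Measurable fun q : (EuclideanSpace ℝ (Fin n) × EuclideanSpace ℝ (Fin n)) ×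
      EuclideanSpace ℝ (Fin n) => advance a L B k q.1 q.2 := by
  have h1 := (measurable_clip (n := n) (B / alpha a L (k + 1)))
  have h2 := measurable_queryPoint (n := n) a L k
  unfold advance
  fun_prop

lemma measurable_miniBatch (hg : Measurable (Function.uncurry g)) (m : ℕ) :
    Measurable fun q : (ℕ → S) × EuclideanSpace ℝ (Fin n) => miniBatch g m q.1 q.2 := by
  have h : ∀ i : ℕ, Measurable fun q : (ℕ → S) × EuclideanSpace ℝ (Fin n) => g q.2 (q.1 i) :=
    fun i => hg.comp (measurable_snd.prodMk ((measurable_pi_apply i).comp measurable_fst))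
  have hsum : Measurable fun q : (ℕ → S) × EuclideanSpace ℝ (Fin n) =>
      ∑ i ∈ range m, g q.2 (q.1 i) := Finset.measurable_sum _ fun i _ => h i
  exact hsum.const_smul (m : ℝ)⁻¹

lemma measurable_sstm_step (hg : Measurable (Function.uncurry g)) (a L B : ℝ) (m k : ℕ) :
    Measurable fun q : (EuclideanSpace ℝ (Fin n) × EuclideanSpace ℝ (Fin n)) × (ℕ → S) =>
      advance a L B k q.1 (miniBatch g m q.2 (queryPoint a L k q.1)) := by
  have h1 : Measurable fun q : (EuclideanSpace ℝ (Fin n) × EuclideanSpace ℝ (Fin n)) × (ℕ → S) =>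
      (q.2, queryPoint a L k q.1) :=
    measurable_snd.prodMk ((measurable_queryPoint a L k).comp measurable_fst)
  have h2 : Measurable fun q : (EuclideanSpace ℝ (Fin n) × EuclideanSpace ℝ (Fin n)) × (ℕ → S) =>
      (q.1, miniBatch g m q.2 (queryPoint a L k q.1)) :=
    measurable_fst.prodMk ((measurable_miniBatch hg m).comp h1)
  have h3 := (measurable_advance a L B k).comp h2
  exact h3

/-- The σ-algebra on `Ω` is arbitrary and only samples of iterations before `N` enter, so that it
can be applied to `pastSigma`. -/
lemma measurable_sstm [MeasurableSpace Ω] (hg : Measurable (Function.uncurry g)) (L a B : ℝ)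
    (m : ℕ → ℕ) {ζ : ℕ → ℕ → Ω → S} {X : Ω → EuclideanSpace ℝ (Fin n)} (hX : Measurable X)
    {N : ℕ} (hζ : ∀ k < N, ∀ i, Measurable (ζ k i)) :
    Measurable fun ω => sstm g L a B m (fun k i => ζ k i ω) (X ω) N := by
  induction N with
  | zero => exact hX.prodMk hX
  | succ N ih =>
    have h := ih fun k hk => hζ k (hk.trans (Nat.lt_succ_self N))
    have hb : Measurable fun ω i => ζ N i ω :=
      measurable_pi_iff.2 fun i => hζ N (Nat.lt_succ_self N) i
    have h' := (measurable_sstm_step hg a L B (m N) N).comp (h.prodMk hb)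
    simp only [sstm_succ]
    exact h'

lemma measurable_potential (a L : ℝ) {f : EuclideanSpace ℝ (Fin n) → ℝ} (hf : Measurable f)
    (xs : EuclideanSpace ℝ (Fin n)) (k : ℕ) : Measurable (potential a L f xs k) := by
  unfold potential
  fun_prop

/-- The information contained in the samples drawn before iteration `k` of run `t`. -/
@[reducible]
def pastSigma (ξ : ℕ → ℕ → ℕ → Ω → S) (t k : ℕ) : MeasurableSpace Ω :=
  ⨆ p ∈ {p : ℕ × ℕ × ℕ | p.1 < t ∨ p.1 = t ∧ p.2.1 < k},
    MeasurableSpace.comap (ξ p.1 p.2.1 p.2.2) inferInstance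

lemma measurable_pastSigma {ξ : ℕ → ℕ → ℕ → Ω → S} {t k t' k' : ℕ}
    (h : t' < t ∨ t' = t ∧ k' < k) (i : ℕ) : Measurable[pastSigma ξ t k] (ξ t' k' i) := by
  refine Measurable.mono (comap_measurable (ξ t' k' i)) ?_ le_rfl
  exact le_iSup₂_of_le (f := fun (p : ℕ × ℕ × ℕ)
    (_ : p ∈ {p : ℕ × ℕ × ℕ | p.1 < t ∨ p.1 = t ∧ p.2.1 < k}) =>
    MeasurableSpace.comap (ξ p.1 p.2.1 p.2.2) inferInstance) (t', k', i) h le_rfl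

lemma pastSigma_mono {ξ : ℕ → ℕ → ℕ → Ω → S} {t k t' k' : ℕ} (h : t' < t ∨ t' = t ∧ k' ≤ k) :
    pastSigma ξ t' k' ≤ pastSigma ξ t k := by
  refine biSup_mono fun p hp => ?_
  simp only [Set.mem_ofPred_eq] at hp ⊢
  omega

lemma measurable_restartedSSTM {ξ : ℕ → ℕ → ℕ → Ω → S} (hg : Measurable (Function.uncurry g)) (L a : ℝ) (N₀ : ℕ)
    (B : ℕ → ℝ) (m : ℕ → ℕ → ℕ) (x₀ : EuclideanSpace ℝ (Fin n)) (t : ℕ) :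
    Measurable[pastSigma ξ t 0]
      fun ω => restartedSSTM g L a N₀ B m (fun t k i => ξ t k i ω) x₀ t := by
  induction t with
  | zero => exact @measurable_const _ _ _ (pastSigma ξ 0 0) _
  | succ t ih =>
    have h := @measurable_sstm n S Ω _ g (pastSigma ξ (t + 1) 0) hg L a (B t) (m t) (ξ t) _
      (ih.mono (pastSigma_mono (Or.inl (Nat.lt_succ_self t))) le_rfl) N₀
      fun k _ i => measurable_pastSigma (Or.inl (Nat.lt_succ_self t)) i
    exact measurable_fst.comp h

variable [MeasurableSpace Ω] {Pr : Measure Ω} {P : Measure S} {ξ : ℕ → ℕ → ℕ → Ω → S}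

lemma IsIIDSample.pastSigma_le (hξ : IsIIDSample Pr P ξ) (t k : ℕ) :
    pastSigma ξ t k ≤ (inferInstance : MeasurableSpace Ω) :=
  iSup₂_le fun _ _ => (hξ.measurable _ _ _).comap_le

/-- The samples of an iteration are independent of what has been computed before. -/
lemma IsIIDSample.indepFun_batch (hξ : IsIIDSample Pr P ξ) (t k : ℕ) {A : Type*}
    [MeasurableSpace A] {U : Ω → A} (hU : Measurable[pastSigma ξ t k] U) :
    IndepFun U (fun ω i => ξ t k i ω) Pr := by
  have hdisj : Disjoint {p : ℕ × ℕ × ℕ | p.1 < t ∨ p.1 = t ∧ p.2.1 < k}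
      {p : ℕ × ℕ × ℕ | p.1 = t ∧ p.2.1 = k} := by
    rw [Set.disjoint_left]
    intro p h1 h2
    simp only [Set.mem_ofPred_eq] at h1 h2
    omega
  have h := indep_iSup_of_disjoint (fun p : ℕ × ℕ × ℕ => (hξ.measurable p.1 p.2.1 p.2.2).comap_le)
    ((iIndepFun_iff_iIndep _ _ _).1 hξ.indep) hdisj
  rw [IndepFun_iff_Indep]
  refine indep_of_indep_of_le h hU.comap_le (Measurable.comap_le ?_)
  refine @measurable_pi_lambda _ _ _ (_) _ _ fun i => ?_
  refine Measurable.mono (comap_measurable (ξ t k i)) ?_ le_rfl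
  exact le_iSup₂_of_le (f := fun (p : ℕ × ℕ × ℕ) (_ : p ∈ {p : ℕ × ℕ × ℕ | p.1 = t ∧ p.2.1 = k}) =>
    MeasurableSpace.comap (ξ p.1 p.2.1 p.2.2) inferInstance) (t, k, i) ⟨rfl, rfl⟩ le_rfl

lemma IsIIDSample.pairwise_indepFun (hξ : IsIIDSample Pr P ξ) (t k : ℕ) :
    Pairwise fun i j => IndepFun (ξ t k i) (ξ t k j) Pr := fun i j hij =>
  hξ.indep.indepFun (i := (t, k, i)) (j := (t, k, j)) (by simpa using hij)

end Measurability

/-! ### One run of clipped-SSTM -/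

section HighProbability

variable {n : ℕ} {S Ω : Type*} [MeasurableSpace S] [MeasurableSpace Ω]
  {Pr : Measure Ω} [IsProbabilityMeasure Pr] {P : Measure S}
  {f : EuclideanSpace ℝ (Fin n) → ℝ} {g : EuclideanSpace ℝ (Fin n) → S → EuclideanSpace ℝ (Fin n)}
  {ξ : ℕ → ℕ → ℕ → Ω → S} {xs : EuclideanSpace ℝ (Fin n)} {μ L σ a l ρ : ℝ}

/-- A run of clipped-SSTM that starts in the ball of radius `ρ / √5` ends with a potential above
`ρ ^ 2` only with exponentially small probability. -/
lemma measure_potential_gt_le (hμ : 0 < μ)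
    (hL : 0 < L) (hc : IsStronglyConvex μ f) (hf : IsSmooth L f) (hxs : ∀ x, f xs ≤ f x)
    (hg : IsStochasticGradient P σ f g) (hξ : IsIIDSample Pr P ξ)
    (hl : 2 ≤ l) (hρ : 0 < ρ) (ha : 576 * l ^ 2 ≤ a) {m : ℕ → ℕ} (hm : ∀ k, 1 ≤ m k) {N : ℕ}
    (hN : 1 ≤ N)
    (hmk : ∀ k, 440 * l * N * alpha a L (k + 1) ^ 2 * σ ^ 2 ≤ ρ ^ 2 * m k) (t : ℕ)
    {X : Ω → EuclideanSpace ℝ (Fin n)} (hX : Measurable[pastSigma ξ t 0] X) :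
    Pr {ω | ‖X ω - xs‖ ^ 2 ≤ ρ ^ 2 / 5 ∧ ρ ^ 2 <
      potential a L f xs N (sstm g L a (ρ / (8 * l)) m (fun k i => ξ t k i ω) (X ω) N)} ≤
      ENNReal.ofReal (Real.exp (-l)) := by
  have hl0 : 0 < l := by linarith
  have hN0 : (0 : ℝ) < N := by exact_mod_cast hN
  have hfm : Measurable f := hf.1.continuous.measurable
  -- With this `s`, start `ρ²/5` and level `ρ²`, the final exponent is `2l/5 - 2l + l/2 = -11l/10 ≤
  -- -l`.
  set s : ℝ := 2 * l / ρ ^ 2 with hs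
  set U : ℕ → Ω → EuclideanSpace ℝ (Fin n) × EuclideanSpace ℝ (Fin n) := fun k ω =>
    sstm g L a (ρ / (8 * l)) m (fun k i => ξ t k i ω) (X ω) k with hU
  set V : ℕ → Ω → ℝ := fun k ω => potential a L f xs k (U k ω) with hV
  have hUpast : ∀ k, Measurable[pastSigma ξ t k] (U k) := fun k =>
    @measurable_sstm n S Ω _ g (pastSigma ξ t k) hg.measurable L a _ m (ξ t) X
      (hX.mono (pastSigma_mono (Or.inr ⟨rfl, Nat.zero_le k⟩)) le_rfl) k
      fun j hj i => measurable_pastSigma (Or.inr ⟨rfl, hj⟩) i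
  have hVpast : ∀ k, ∀ j ≤ k, Measurable[pastSigma ξ t k] (V j) := fun k j hj =>
    (measurable_potential a L hfm xs j).comp
      ((hUpast j).mono (pastSigma_mono (Or.inr ⟨rfl, hj⟩)) le_rfl)
  have hle := hξ.pastSigma_le t
  have hV0 : ∀ ω, V 0 ω = ‖X ω - xs‖ ^ 2 := fun ω => by
    simp [hV, hU, potential, sstm, bigA]
  have hstep : ∀ k < N,
      ∫⁻ ω in {ω | V 0 ω ≤ ρ ^ 2 / 5 ∧ ∀ j ≤ k, V j ω ≤ ρ ^ 2},
        ENNReal.ofReal (Real.exp (s * V (k + 1) ω)) ∂Pr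
        ≤ ENNReal.ofReal (Real.exp (l / (2 * N))) *
      ∫⁻ ω in {ω | V 0 ω ≤ ρ ^ 2 / 5 ∧ ∀ j ≤ k, V j ω ≤ ρ ^ 2},
        ENNReal.ofReal (Real.exp (s * V k ω)) ∂Pr := by
    intro k _
    set D : Set Ω := {ω | V 0 ω ≤ ρ ^ 2 / 5 ∧ ∀ j ≤ k, V j ω ≤ ρ ^ 2} with hD
    have hDpast : MeasurableSet[pastSigma ξ t k] D := by
      have : D = {ω | V 0 ω ≤ ρ ^ 2 / 5} ∩ ⋂ j ∈ Set.Iic k, {ω | V j ω ≤ ρ ^ 2} := by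
        ext ω; simp [hD]
      rw [this]
      exact ((hVpast k 0 (Nat.zero_le _)) measurableSet_Iic).inter
        (MeasurableSet.biInter (Set.to_countable _) fun j hj => (hVpast k j hj) measurableSet_Iic)
    have hDm : MeasurableSet D := hle k _ hDpast
    have hUm : Measurable (U k) := (hUpast k).mono (hle k) le_rfl
    have hbm : Measurable fun ω i => ξ t k i ω := measurable_pi_iff.2 fun i => hξ.measurable t k i
    have hone : Measurable[pastSigma ξ t k] (1 : Ω → ENNReal) :=
      @measurable_const _ _ _ (pastSigma ξ t k) 1
    have hWU : Measurable[pastSigma ξ t k] fun ω => (D.indicator (1 : Ω → ENNReal) ω, U k ω) :=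
      (hone.indicator hDpast).prodMk (hUpast k)
    have hG : Measurable fun q : (EuclideanSpace ℝ (Fin n) × EuclideanSpace ℝ (Fin n)) × (ℕ → S) =>
        ENNReal.ofReal (Real.exp (s * potential a L f xs (k + 1)
          (advance a L (ρ / (8 * l)) k q.1 (miniBatch g (m k) q.2 (queryPoint a L k q.1))))) :=
      (((measurable_potential a L hfm xs (k + 1)).comp
        (measurable_sstm_step hg.measurable a L _ (m k) k)).const_mul s).exp.ennreal_ofReal
    have hcond := setLIntegral_comp_prod_of_indepFun hDm hUm hbm
      (hξ.indepFun_batch t k hWU) hG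
    change ∫⁻ ω in D, ENNReal.ofReal (Real.exp (s * V (k + 1) ω)) ∂Pr = _ at hcond
    rw [hcond, ← lintegral_const_mul' _ _ ENNReal.ofReal_ne_top]
    refine setLIntegral_mono' hDm fun ω hω => ?_
    refine lintegral_exp_potential_advance_le hμ hL hc hf hxs hg (hξ.measurable t k) (hξ.law t k)
      (hξ.pairwise_indepFun t k) hl hρ ha (hm k) k ?_ (U k ω) (hω.2 k le_rfl)
    have hmk0 : (0 : ℝ) < m k := by exact_mod_cast hm k
    -- The batch condition with constant `440` gives the growth rate `l/(2N)` per step.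
    rw [div_mul_div_comm, div_le_div_iff₀ (by positivity) (by positivity)]
    have := mul_le_mul_of_nonneg_left (hmk k) hl0.le
    linarith
  have hmain := measure_gt_le_of_lintegral_exp_le (s := s) (v₀ := ρ ^ 2 / 5) (M := ρ ^ 2)
    (by positivity) (fun k _ => (hVpast k k le_rfl).mono (hle k) le_rfl) hstep (by positivity)
    (by linarith [sq_nonneg ρ])
  simp only [hV0] at hmain
  refine hmain.trans (ENNReal.ofReal_le_ofReal (Real.exp_le_exp.2 ?_))
  have h1 : s * (ρ ^ 2 / 5) = 2 * l / 5 := by rw [hs]; field_simp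
  have h2 : s * ρ ^ 2 = 2 * l := by rw [hs]; field_simp
  have h3 : (N : ℝ) * (l / (2 * N)) = l / 2 := by field_simp
  rw [h1, h2, h3]
  linarith

/-! ### The restarted method -/

/-- Only the third entry of the maximum matters: `36 (2l + 2l)² = 576 l²`. -/
lemma aMin_ge {N₀ τ : ℕ} {β : ℝ} (hl : 2 ≤ logTerm N₀ τ β) :
    576 * logTerm N₀ τ β ^ 2 ≤ aMin N₀ τ β := by
  set l := logTerm N₀ τ β with hldef
  have h1 : 2 * l ≤ √(4 * l ^ 2 + 2 * l) := Real.le_sqrt_of_sq_le (by nlinarith)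
  calc 576 * l ^ 2 = 36 * (2 * l + 2 * l) ^ 2 := by ring
    _ ≤ 36 * (2 * l + √(4 * l ^ 2 + 2 * l)) ^ 2 := by gcongr
    _ ≤ aMin N₀ τ β := (le_max_right _ _).trans (le_max_right _ _)

lemma one_le_batchSize (L a σ R β : ℝ) (N₀ τ t k : ℕ) : 1 ≤ batchSize L a σ R β N₀ τ t k := by
  have h : (1 : ℝ) ≤ batchSize L a σ R β N₀ τ t k := (le_max_left _ _).trans (Nat.le_ceil _)
  exact_mod_cast h

/-- Exhibits the clipping parameter as `ρ / (8 l)` with `ρ = √5 R / √2 ^ t`, the form used for one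
run. -/
lemma clipParam_eq (R β : ℝ) (N₀ τ t : ℕ) :
    clipParam R β N₀ τ t = √5 * R / √2 ^ t / (8 * logTerm N₀ τ β) := by
  have h : (2 : ℝ) ^ ((t : ℝ) / 2) = √2 ^ t := by
    rw [Real.sqrt_eq_rpow, ← Real.rpow_natCast, ← Real.rpow_mul (by norm_num)]
    congr 1
    ring
  rw [clipParam, h]
  field_simp

lemma sq_sqrt_mul_div_sqrt_pow (R : ℝ) (t : ℕ) : (√5 * R / √2 ^ t) ^ 2 = 5 * R ^ 2 / 2 ^ t := by
  rw [div_pow, mul_pow, Real.sq_sqrt (by norm_num), ← pow_mul, mul_comm t 2, pow_mul,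
    Real.sq_sqrt (by norm_num)]

/-- The high-probability bound for R-clipped-SSTM. -/
theorem restartedSSTM_highProbability (x₀ : EuclideanSpace ℝ (Fin n)) {β : ℝ} {N₀ τ : ℕ}
    (hμ : 0 < μ) (hL : 0 < L) (hc : IsStronglyConvex μ f) (hf : IsSmooth L f)
    (hxs : ∀ x, f xs ≤ f x)
    (hg : IsStochasticGradient P σ f g) (hξ : IsIIDSample Pr P ξ)
    (hβ : 0 < β) (hN₀ : 1 ≤ N₀) (hl : 2 ≤ logTerm N₀ τ β)
    (ha : aMin N₀ τ β ≤ a) (hN : √5 * √(8 * a * L / μ) ≤ N₀) :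
    ENNReal.ofReal (1 - β) ≤
      Pr {ω | f (output g L a σ (radius μ f x₀ xs) β N₀ τ (fun t k i => ξ t k i ω) x₀) - f xs
        ≤ (2 : ℝ)⁻¹ ^ τ * (f x₀ - f xs)} := by
  set R := radius μ f x₀ xs with hR
  set Δ := f x₀ - f xs with hΔ
  set l := logTerm N₀ τ β with hldef
  have hΔ0 : 0 ≤ Δ := by linarith [hxs x₀]
  have ha576 : 576 * l ^ 2 ≤ a := (aMin_ge hl).trans ha
  have ha0 : 0 < a := by nlinarith
  have hR2 : R ^ 2 = 2 * Δ / μ := by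
    rw [hR, radius, Real.sq_sqrt (by positivity)]
  have hR0 : 0 ≤ R := Real.sqrt_nonneg _
  set X : ℕ → Ω → EuclideanSpace ℝ (Fin n) := fun t ω =>
    restartedSSTM g L a N₀ (clipParam R β N₀ τ) (batchSize L a σ R β N₀ τ)
      (fun t k i => ξ t k i ω) x₀ t with hX
  rcases hR0.eq_or_lt with hR00 | hRpos
  · have hΔ00 : Δ = 0 := by
      rw [← hR00] at hR2
      field_simp at hR2
      linarith
    have hXconst : ∀ t ω, X t ω = x₀ := by
      intro t ω
      induction t with
      | zero => rfl
      | succ t ih =>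
        have hB : clipParam R β N₀ τ t = 0 := by rw [← hR00]; simp [clipParam]
        change (sstm g L a (clipParam R β N₀ τ t) _ _ (X t ω) N₀).1 = x₀
        rw [hB, sstm_clip_zero g L a _ _ _ ha0 hL, ih]
    have huniv : {ω | f (output g L a σ R β N₀ τ (fun t k i => ξ t k i ω) x₀) - f xs
        ≤ (2 : ℝ)⁻¹ ^ τ * Δ} = Set.univ := by
      refine Set.eq_univ_of_forall fun ω => ?_
      change f (X τ ω) - f xs ≤ _
      rw [hXconst, ← hΔ, hΔ00, mul_zero]
    rw [huniv, measure_univ]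
    exact ENNReal.ofReal_le_one.2 (by linarith)
  -- For `τ = 0` the logarithm is `Real.log 0 = 0`, which is below 2.
  have hτ : 1 ≤ τ := by
    by_contra! h
    have : τ = 0 := by omega
    subst this
    simp only [hldef, logTerm, Nat.cast_zero, mul_zero, zero_div, Real.log_zero] at hl
    norm_num at hl
  -- Run `t` starts within its target and misses the next one. Keeping the good start inside the
  -- event avoids conditioning on it.
  set bad : ℕ → Set Ω := fun t => {ω | f (X t ω) - f xs ≤ (2 : ℝ)⁻¹ ^ t * Δ ∧
    (2 : ℝ)⁻¹ ^ (t + 1) * Δ < f (X (t + 1) ω) - f xs} with hbad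
  have hbadle : ∀ t, Pr (bad t) ≤ ENNReal.ofReal (Real.exp (-l)) := by
    intro t
    set ρ := √5 * R / √2 ^ t with hρdef
    have hρ : 0 < ρ := by positivity
    have hρ2 : ρ ^ 2 = 5 * R ^ 2 / 2 ^ t := sq_sqrt_mul_div_sqrt_pow R t
    have hρΔ : μ * ρ ^ 2 = 10 * ((2 : ℝ)⁻¹ ^ t * Δ) := by
      rw [hρ2, hR2, inv_pow]
      field_simp
      ring
    have hrun := measure_potential_gt_le (m := batchSize L a σ R β N₀ τ t) hμ hL hc hf hxs hg hξ
      hl hρ ha576 (one_le_batchSize L a σ R β N₀ τ t) hN₀ (fun k => by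
        have h1 : 6000 * 2 ^ t * σ ^ 2 * alpha a L (k + 1) ^ 2 * N₀ * l / (√5 ^ 2 * R ^ 2) ≤
            batchSize L a σ R β N₀ τ t k :=
          (le_max_left _ _).trans ((le_max_right _ _).trans (Nat.le_ceil _))
        have h2 := mul_le_mul_of_nonneg_left h1 (sq_nonneg ρ)
        have h3 : ρ ^ 2 * (6000 * 2 ^ t * σ ^ 2 * alpha a L (k + 1) ^ 2 * N₀ * l /
            (√5 ^ 2 * R ^ 2)) = 6000 * (l * N₀ * alpha a L (k + 1) ^ 2 * σ ^ 2) := by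
          rw [hρ2, Real.sq_sqrt (by norm_num)]
          field_simp
        have h4 : 0 ≤ l * N₀ * alpha a L (k + 1) ^ 2 * σ ^ 2 := by
          have : 0 < l := by linarith
          positivity
        linarith) t (X := X t)
      (measurable_restartedSSTM hg.measurable L a N₀ _ _ x₀ t)
    refine (measure_mono fun ω hω => ?_).trans hrun
    refine ⟨?_, ?_⟩
    -- Strong convexity turns the gap bound `2^(-t) Δ` into squared distance at most `2 · 2^(-t) Δ /
    -- μ = ρ²/5`.
    · have h1 := hc.norm_sub_sq_le hμ hL hf hxs (X t ω)
      have h2 : 2 * (f (X t ω) - f xs) / μ ≤ 2 * ((2 : ℝ)⁻¹ ^ t * Δ) / μ := by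
        gcongr
        exact hω.1
      have h3 : ρ ^ 2 = 10 * ((2 : ℝ)⁻¹ ^ t * Δ) / μ := by
        rw [← hρΔ]; field_simp
      rw [h3]
      refine (h1.trans h2).trans (le_of_eq ?_)
      field_simp
      ring
    · by_contra! h
      have h1 := sub_le_of_potential_le hμ hL ha0 hN _ hxs h
      rw [hρΔ] at h1
      have h2 := hω.2
      have h3 : X (t + 1) ω = (sstm g L a (ρ / (8 * l)) (batchSize L a σ R β N₀ τ t)
          (fun k i => ξ t k i ω) (X t ω) N₀).1 := by
        rw [hρdef, ← clipParam_eq]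
        rfl
      rw [h3, pow_succ] at h2
      linarith
  have hcover : {ω | f (output g L a σ R β N₀ τ (fun t k i => ξ t k i ω) x₀) - f xs
      ≤ (2 : ℝ)⁻¹ ^ τ * Δ}ᶜ ⊆ ⋃ t ∈ range τ, bad t := by
    intro ω hω
    by_contra h
    simp only [Set.mem_iUnion, not_exists, Finset.mem_range] at h
    refine hω ?_
    have hgood : ∀ t ≤ τ, f (X t ω) - f xs ≤ (2 : ℝ)⁻¹ ^ t * Δ := by
      intro t
      induction t with
      | zero =>
        intro _
        simp [hX, restartedSSTM, hΔ]
      | succ t ih =>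
        intro ht
        by_contra! h'
        exact h t ht ⟨ih (by omega), h'⟩
    exact hgood τ le_rfl
  -- Here `exp (-l) = β / (4 N₀ τ)`.
  have hexp : (τ : ℝ) * Real.exp (-l) ≤ β := by
    have hN0 : (1 : ℝ) ≤ N₀ := by exact_mod_cast hN₀
    have hτ0 : (1 : ℝ) ≤ τ := by exact_mod_cast hτ
    rw [hldef, logTerm, Real.exp_neg, Real.exp_log (by positivity), inv_div,
      mul_div_assoc', div_le_iff₀ (by positivity)]
    nlinarith [mul_le_mul hN0 (le_refl (β * τ)) (by positivity) (by positivity),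
      mul_pos hβ (by positivity : (0 : ℝ) < τ)]
  have hcompl : Pr {ω | f (output g L a σ R β N₀ τ (fun t k i => ξ t k i ω) x₀) - f xs
      ≤ (2 : ℝ)⁻¹ ^ τ * Δ}ᶜ ≤ ENNReal.ofReal β := by
    calc _ ≤ Pr (⋃ t ∈ range τ, bad t) := measure_mono hcover
      _ ≤ ∑ t ∈ range τ, Pr (bad t) := measure_biUnion_finset_le _ _
      _ ≤ ∑ t ∈ range τ, ENNReal.ofReal (Real.exp (-l)) := sum_le_sum fun t _ => hbadle t
      _ = ENNReal.ofReal (τ * Real.exp (-l)) := by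
          rw [sum_const, card_range, nsmul_eq_mul, ENNReal.ofReal_mul (by positivity),
            ENNReal.ofReal_natCast]
      _ ≤ _ := ENNReal.ofReal_le_ofReal hexp
  have hone : 1 ≤ Pr {ω | f (output g L a σ R β N₀ τ (fun t k i => ξ t k i ω) x₀) - f xs
      ≤ (2 : ℝ)⁻¹ ^ τ * Δ} + ENNReal.ofReal β := by
    rw [← measure_univ (μ := Pr), ← Set.union_compl_self {ω | f (output g L a σ R β N₀ τ
      (fun t k i => ξ t k i ω) x₀) - f xs ≤ (2 : ℝ)⁻¹ ^ τ * Δ}]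
    exact (measure_union_le _ _).trans (by gcongr)
  rw [ENNReal.ofReal_sub _ hβ.le, ENNReal.ofReal_one]
  exact tsub_le_iff_right.2 hone

end HighProbability

/-! ### The choice of the number of iterations -/

section Parameters

lemma aMin_le {N₀ τ : ℕ} {β : ℝ} (hl : 2 ≤ logTerm N₀ τ β) :
    aMin N₀ τ β ≤ 900 * logTerm N₀ τ β ^ 2 := by
  rw [aMin]
  set l := logTerm N₀ τ β
  have h1 : √(4 * l ^ 2 + 2 * l) ≤ 3 * l := Real.sqrt_le_iff.2 ⟨by linarith, by nlinarith⟩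
  have h2 : 1 ≤ √5 := Real.one_le_sqrt.2 (by norm_num)
  refine max_le (by nlinarith) (max_le ?_ ?_)
  · exact (div_le_self (by linarith) h2).trans (by nlinarith)
  · calc 36 * (2 * l + √(4 * l ^ 2 + 2 * l)) ^ 2 ≤ 36 * (2 * l + 3 * l) ^ 2 := by gcongr
      _ = 900 * l ^ 2 := by ring

lemma logTerm_le_logTerm {M N τ : ℕ} {β : ℝ} (hM : 1 ≤ M) (hMN : M ≤ N) (hτ : 1 ≤ τ)
    (hβ : 0 < β) : logTerm M τ β ≤ logTerm N τ β := by
  have h1 : (1 : ℝ) ≤ M := by exact_mod_cast hM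
  have h2 : (1 : ℝ) ≤ τ := by exact_mod_cast hτ
  rw [logTerm, logTerm]
  gcongr

lemma aMin_le_aMin {M N τ : ℕ} {β : ℝ} (hl : 0 ≤ logTerm M τ β)
    (hMN : logTerm M τ β ≤ logTerm N τ β) : aMin M τ β ≤ aMin N τ β := by
  rw [aMin, aMin]
  gcongr

lemma one_le_aMin (N₀ τ : ℕ) (β : ℝ) : 1 ≤ aMin N₀ τ β := le_max_left _ _

lemma two_le_logTerm {N τ : ℕ} {β : ℝ} (hN : 2 ≤ N) (hτ : 1 ≤ τ) (hβ : 0 < β) (hβ1 : β < 1) :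
    2 ≤ logTerm N τ β := by
  have h1 : (2 : ℝ) ≤ N := by exact_mod_cast hN
  have h2 : (1 : ℝ) ≤ τ := by exact_mod_cast hτ
  rw [logTerm, Real.le_log_iff_exp_le (by positivity), le_div_iff₀ hβ]
  have h3 : Real.exp 2 ≤ 8 := by
    rw [show (2 : ℝ) = 1 + 1 by norm_num, Real.exp_add]
    nlinarith [Real.exp_one_lt_d9, Real.exp_pos 1]
  nlinarith [Real.exp_pos 2, mul_le_mul h1 h2 zero_le_one (by linarith)]

/-- Although `aMin` depends on `N`, it is `O(log² N)`, so the required number of iterations grows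
only like `log N`. -/
lemma eventually_sqrt_aMin_le {κ : ℝ} (hκ : 0 ≤ κ) {τ : ℕ} (hτ : 1 ≤ τ) {β : ℝ} (hβ : 0 < β)
    (hβ1 : β < 1) : ∀ᶠ N : ℕ in Filter.atTop, √5 * √(8 * aMin N τ β * κ) ≤ N := by
  have hτ0 : (1 : ℝ) ≤ τ := by exact_mod_cast hτ
  set c := √5 * √(7200 * κ) with hc
  have ho : (fun x : ℝ => c * (Real.log (4 * τ / β) + Real.log x)) =o[Filter.atTop]
      (id : ℝ → ℝ) :=
    ((Asymptotics.isLittleO_const_id_atTop _).add Real.isLittleO_log_id_atTop).const_mul_left c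
  have hev := (ho.bound zero_lt_one).natCast_atTop
  filter_upwards [hev, Filter.eventually_ge_atTop 2] with N hN hN2
  have hN0 : (2 : ℝ) ≤ N := by exact_mod_cast hN2
  have hl := two_le_logTerm hN2 hτ hβ hβ1
  have hlog : logTerm N τ β = Real.log (4 * τ / β) + Real.log N := by
    rw [logTerm, ← Real.log_mul (by positivity) (by positivity)]
    congr 1
    ring
  rw [← hlog, id, one_mul, Real.norm_of_nonneg (by linarith : (0 : ℝ) ≤ N)] at hN
  refine le_trans ?_ ((Real.le_norm_self _).trans hN)
  rw [hc, mul_assoc √5]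
  refine mul_le_mul_of_nonneg_left ?_ (Real.sqrt_nonneg _)
  calc √(8 * aMin N τ β * κ) ≤ √(8 * (900 * logTerm N τ β ^ 2) * κ) := by
        gcongr
        exact aMin_le hl
    _ = √(7200 * κ * logTerm N τ β ^ 2) := by ring_nf
    _ = √(7200 * κ) * logTerm N τ β := by
        rw [Real.sqrt_mul (by positivity), Real.sqrt_sq (by linarith)]

/-- An admissible number of iterations exists. -/
theorem exists_iterations {μ L β : ℝ} {τ : ℕ} (hμ : 0 < μ) (hμL : μ ≤ L) (hβ : 0 < β)
    (hβ1 : β < 1) (hτ : 1 ≤ τ) :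
    ∃ N₀ : ℕ, 1 ≤ N₀ ∧ 2 ≤ logTerm N₀ τ β ∧ √5 * √(8 * aMin N₀ τ β * L / μ) ≤ N₀ ∧
      N₀ ≤ 2 * √5 * √(8 * aMin N₀ τ β * L / μ) := by
  classical
  have hκ : 1 ≤ L / μ := (one_le_div hμ).2 hμL
  -- The least such `N` is the witness. If `N ≥ 3`, then `N - 1` fails the bound, and monotonicity
  -- of `aMin` with `N ≤ 2 (N - 1)` gives the upper bound.
  have hex : ∃ N : ℕ, 2 ≤ N ∧ √5 * √(8 * aMin N τ β * (L / μ)) ≤ N :=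
    ((Filter.eventually_ge_atTop 2).and
      (eventually_sqrt_aMin_le (by linarith : 0 ≤ L / μ) hτ hβ hβ1)).exists
  obtain ⟨hN2, hN⟩ := Nat.find_spec hex
  set N := Nat.find hex with hNdef
  have hl := two_le_logTerm hN2 hτ hβ hβ1
  refine ⟨N, by omega, hl, by rwa [mul_div_assoc], ?_⟩
  rw [mul_div_assoc, mul_assoc]
  rcases hN2.eq_or_lt with h2 | h3
  · rw [← h2]
    have h5 : 1 ≤ √5 := Real.one_le_sqrt.2 (by norm_num)
    have h6 : 1 ≤ √(8 * aMin 2 τ β * (L / μ)) := Real.one_le_sqrt.2 (by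
      nlinarith [one_le_aMin 2 τ β])
    push_cast
    nlinarith
  · have hmin := Nat.find_min hex (m := N - 1) (by omega)
    have hlt : ((N - 1 : ℕ) : ℝ) < √5 * √(8 * aMin (N - 1) τ β * (L / μ)) := by
      by_contra! h
      exact hmin ⟨by omega, h⟩
    have hl' := two_le_logTerm (N := N - 1) (by omega) hτ hβ hβ1
    have hmono : aMin (N - 1) τ β ≤ aMin N τ β := aMin_le_aMin (by linarith)
      (logTerm_le_logTerm (by omega) (Nat.sub_le N 1) hτ hβ)
    have hle : √5 * √(8 * aMin (N - 1) τ β * (L / μ)) ≤ √5 * √(8 * aMin N τ β * (L / μ)) := by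
      gcongr
    have h3' : (3 : ℝ) ≤ N := by exact_mod_cast h3
    rw [Nat.cast_sub (by omega), Nat.cast_one] at hlt
    linarith

end Parameters

/-! ### Complexity -/

section Complexity

variable {μ L σ β ε R a C₁ q : ℝ} {N₀ τ : ℕ}

lemma one_le_of_two_le_logTerm (hl : 2 ≤ logTerm N₀ τ β) : 1 ≤ τ := by
  by_contra! h
  obtain rfl : τ = 0 := by omega
  simp only [logTerm, Nat.cast_zero, mul_zero, zero_div, Real.log_zero] at hl
  norm_num at hl

/-- Bounds for the number of restarts `⌈log₂ y⌉₊`. -/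
lemma ceil_logb_bounds {y : ℝ} (hy : 0 ≤ y) (hτ : τ = ⌈Real.logb 2 y⌉₊) (h1 : 1 ≤ τ) :
    1 < y ∧ y ≤ 2 ^ τ ∧ (2 : ℝ) ^ τ ≤ 2 * y ∧ τ * Real.log 2 ≤ Real.log (2 * y) := by
  -- The natural-number ceiling is zero at nonpositive arguments, so `1 ≤ τ` forces a positive
  -- logarithm.
  have hpos : 0 < Real.logb 2 y := Nat.ceil_pos.1 (hτ ▸ h1)
  have hy0 : 0 < y := hy.lt_of_ne fun h => by simp [← h] at hpos
  have hy1 : 1 < y := (Real.logb_pos_iff (by norm_num) hy0).1 hpos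
  have hlt : (τ : ℝ) < Real.logb 2 y + 1 := hτ ▸ Nat.ceil_lt_add_one hpos.le
  have hle : Real.logb 2 y ≤ τ := hτ ▸ Nat.le_ceil _
  have hlog2 : 0 < Real.log 2 := Real.log_pos (by norm_num)
  have hlast : τ * Real.log 2 ≤ Real.log (2 * y) := by
    rw [Real.log_mul (by norm_num) hy0.ne']
    have h2 : Real.logb 2 y * Real.log 2 = Real.log y := by
      rw [Real.logb, div_mul_cancel₀ _ hlog2.ne']
    nlinarith
  refine ⟨hy1, ?_, ?_, hlast⟩
  · rw [← Real.rpow_natCast]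
    exact (Real.logb_le_iff_le_rpow (by norm_num) hy0).1 hle
  · rw [← Real.log_pow] at hlast
    exact (Real.log_le_log_iff (by positivity) (by positivity)).1 hlast

/-- The constant is `85² = 7225 ≥ 8 · 900`. -/
lemma iterations_le {l : ℝ} (hμ : 0 < μ) (hL : 0 < L) (hC₁ : 0 ≤ C₁) (hl : 0 ≤ l)
    (ha : a ≤ 900 * l ^ 2) (hN : N₀ ≤ C₁ * √(8 * a * L / μ)) :
    (N₀ : ℝ) ≤ 85 * C₁ * l * √(L / μ) := by
  refine hN.trans ?_
  calc C₁ * √(8 * a * L / μ) ≤ C₁ * √(8 * (900 * l ^ 2) * L / μ) := by gcongr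
    _ ≤ C₁ * √((85 * l) ^ 2 * (L / μ)) := by
        gcongr
        rw [mul_div_assoc]
        gcongr
        nlinarith [sq_nonneg l]
    _ = 85 * C₁ * l * √(L / μ) := by
        rw [Real.sqrt_mul (by positivity), Real.sqrt_sq (by positivity)]
        ring

/-- The logarithm of the number of iterations is controlled by the problem parameters. -/
lemma logTerm_le {X : ℝ} (hμ : 0 < μ) (hμL : μ ≤ L) (hβ : 0 < β) (hC₁ : 1 ≤ C₁) (hq : 1 < q)
    (hl : 2 ≤ logTerm N₀ τ β) (hN₀ : 1 ≤ N₀)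
    (hN : (N₀ : ℝ) ≤ 85 * C₁ * logTerm N₀ τ β * √(L / μ)) (hτX : τ * Real.log 2 ≤ X)
    (hT : q ≤ L / (μ * β) * X) :
    logTerm N₀ τ β ≤ 2 * (Real.log (500 * C₁) / Real.log q + 1) * Real.log (L / (μ * β) * X) := by
  have hτ0 : (1 : ℝ) ≤ τ := by exact_mod_cast one_le_of_two_le_logTerm hl
  have hN0 : (1 : ℝ) ≤ N₀ := by exact_mod_cast hN₀
  set l := logTerm N₀ τ β with hldef
  set T := L / (μ * β) * X with hTdef
  have hlogq : 0 < Real.log q := Real.log_pos hq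
  have hlogT : Real.log q ≤ Real.log T := Real.log_le_log (by linarith) hT
  have hlogC : 0 ≤ Real.log (500 * C₁) := Real.log_nonneg (by linarith)
  have hκ : 1 ≤ L / μ := (one_le_div hμ).2 hμL
  -- This crude bound is harmless inside the logarithm.
  have hsqrt : √(L / μ) ≤ L / μ := Real.sqrt_le_iff.2 ⟨by linarith, by nlinarith⟩
  -- `25/17` exceeds `1 / log 2` and makes `4 · 85 · 25/17 = 500`.
  have hτX' : (τ : ℝ) ≤ 25 / 17 * X := by
    nlinarith [Real.log_two_gt_d9]
  have hX0 : 0 < X := by linarith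
  have harg : 4 * N₀ * τ / β ≤ 500 * C₁ * l * T := by
    calc 4 * N₀ * τ / β ≤ 4 * (85 * C₁ * l * (L / μ)) * (25 / 17 * X) / β := by
          gcongr
          exact hN.trans (by gcongr)
      _ = 500 * C₁ * l * T := by rw [hTdef]; field_simp; ring
  have h1 : l ≤ Real.log (500 * C₁) + Real.log l + Real.log T := by
    rw [← Real.log_mul (by positivity) (by linarith), ← Real.log_mul (by positivity) (by linarith)]
    conv_lhs => rw [hldef, logTerm]
    exact Real.log_le_log (by positivity) harg
  -- Half of `l` absorbs `log l` in `h1`, whence the factor 2 in the conclusion.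
  have h2 : Real.log l ≤ l / 2 := by
    have e1 := Real.log_le_sub_one_of_pos (by linarith : 0 < l / 2)
    rw [Real.log_div (by linarith) (by norm_num)] at e1
    linarith [Real.log_two_lt_d9]
  -- The additive constant becomes a multiple of `log T` because `log T ≥ log q > 0`.
  have h3 : Real.log (500 * C₁) ≤ Real.log (500 * C₁) / Real.log q * Real.log T := by
    rw [div_mul_eq_mul_div, le_div_iff₀ hlogq]
    gcongr
  linarith

/-- For `l ≥ 2`, `6000 l ≥ 10368`, so the second noise term is dominated; the 2 pays for the entry 1
and the rounding. -/
lemma batchSize_le (hl : 2 ≤ logTerm N₀ τ β) (t k : ℕ) :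
    (batchSize L a σ R β N₀ τ t k : ℝ) ≤ 2 +
      6000 * 2 ^ t * σ ^ 2 * alpha a L (k + 1) ^ 2 * N₀ * logTerm N₀ τ β / (√5 ^ 2 * R ^ 2) := by
  set l := logTerm N₀ τ β with hldef
  have hl0 : 0 < l := by linarith
  set u := 6000 * 2 ^ t * σ ^ 2 * alpha a L (k + 1) ^ 2 * N₀ * l / (√5 ^ 2 * R ^ 2) with hu
  have hu0 : 0 ≤ u := by positivity
  have hv : 10368 * 2 ^ t * σ ^ 2 * alpha a L (k + 1) ^ 2 * N₀ / (√5 ^ 2 * R ^ 2) ≤ u := by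
    rw [hu]
    gcongr ?_ / _
    have : 0 ≤ 2 ^ t * σ ^ 2 * alpha a L (k + 1) ^ 2 * N₀ := by positivity
    nlinarith
  rw [batchSize]
  refine (Nat.ceil_lt_add_one (le_trans zero_le_one (le_max_left _ _))).le.trans ?_
  have h : max 1 (max u (10368 * 2 ^ t * σ ^ 2 * alpha a L (k + 1) ^ 2 * N₀ /
      (√5 ^ 2 * R ^ 2))) ≤ 1 + u :=
    max_le (by linarith) (max_le (by linarith) (by linarith))
  linarith

/-- With `α ≤ N₀/(aL)` a run costs order `N₀⁴/(aL)²`, and `N₀² ≤ 8 C₁² aL/μ` cancels `aL`. The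
factors `2^t` sum to less than `2^τ ≤ μR²/ε`. The constant is `1200 · 8²`. -/
lemma oracleCalls_le (hμ : 0 < μ) (hL : 0 < L) (hε : 0 < ε) (hR : 0 < R) (ha : 0 < a)
    (hN₀ : 1 ≤ N₀) (hl : 2 ≤ logTerm N₀ τ β)
    (hN : N₀ ≤ C₁ * √(8 * a * L / μ)) (hτ : (2 : ℝ) ^ τ ≤ μ * R ^ 2 / ε) :
    (oracleCalls N₀ τ (batchSize L a σ R β N₀ τ) : ℝ) ≤
      2 * ((N₀ * τ : ℕ) : ℝ) + 76800 * C₁ ^ 4 * (σ ^ 2 / (μ * ε)) * logTerm N₀ τ β := by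
  set l := logTerm N₀ τ β with hldef
  have hl0 : 0 < l := by linarith
  have hN0 : (1 : ℝ) ≤ N₀ := by exact_mod_cast hN₀
  have hNsq : (N₀ : ℝ) ^ 2 ≤ C₁ ^ 2 * (8 * a * L / μ) := by
    calc (N₀ : ℝ) ^ 2 ≤ (C₁ * √(8 * a * L / μ)) ^ 2 := by gcongr
      _ = _ := by rw [mul_pow, Real.sq_sqrt (by positivity)]
  have hα : ∀ k < N₀, alpha a L (k + 1) ≤ N₀ / (a * L) := by
    intro k hk
    have hk' : (k : ℝ) + 1 ≤ N₀ := by exact_mod_cast hk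
    rw [alpha_succ, div_le_div_iff₀ (by positivity) (by positivity)]
    have : 0 < a * L := by positivity
    nlinarith
  have hterm : ∀ t, ∀ k < N₀, (batchSize L a σ R β N₀ τ t k : ℝ) ≤
      2 + 2 ^ t * (1200 * σ ^ 2 * (N₀ / (a * L)) ^ 2 * N₀ * l / R ^ 2) := by
    intro t k hk
    have hα0 := alpha_succ_pos ha hL k
    refine (batchSize_le hl t k).trans ?_
    calc 2 + 6000 * 2 ^ t * σ ^ 2 * alpha a L (k + 1) ^ 2 * N₀ * l / (√5 ^ 2 * R ^ 2)
        ≤ 2 + 6000 * 2 ^ t * σ ^ 2 * (N₀ / (a * L)) ^ 2 * N₀ * l / (√5 ^ 2 * R ^ 2) := by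
          gcongr
          exact hα k hk
      _ = _ := by
          rw [Real.sq_sqrt (by norm_num)]
          field_simp
          ring
  have hgeom : ∑ t ∈ range τ, (2 : ℝ) ^ t ≤ μ * R ^ 2 / ε := by
    rw [geom_sum_eq (by norm_num)]
    linarith
  rw [oracleCalls]
  push_cast
  calc ∑ t ∈ range τ, ∑ k ∈ range N₀, (batchSize L a σ R β N₀ τ t k : ℝ)
      ≤ ∑ t ∈ range τ, ∑ k ∈ range N₀,
        (2 + 2 ^ t * (1200 * σ ^ 2 * (N₀ / (a * L)) ^ 2 * N₀ * l / R ^ 2)) :=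
        sum_le_sum fun t _ => sum_le_sum fun k hk => hterm t k (Finset.mem_range.1 hk)
    _ = 2 * (N₀ * τ) + (∑ t ∈ range τ, (2 : ℝ) ^ t) *
        (1200 * σ ^ 2 * (N₀ / (a * L)) ^ 2 * N₀ ^ 2 * l / R ^ 2) := by
        simp only [sum_const, card_range, nsmul_eq_mul, mul_add, sum_add_distrib, sum_mul]
        congr 1
        · ring
        · refine sum_congr rfl fun t _ => by ring
    _ ≤ 2 * (N₀ * τ) + (μ * R ^ 2 / ε) *
        (1200 * σ ^ 2 * (N₀ / (a * L)) ^ 2 * N₀ ^ 2 * l / R ^ 2) := by gcongr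
    _ = 2 * (N₀ * τ) + 1200 * σ ^ 2 * μ * l / (ε * (a * L) ^ 2) * ((N₀ : ℝ) ^ 2) ^ 2 := by
        field_simp
    _ ≤ 2 * (N₀ * τ) + 1200 * σ ^ 2 * μ * l / (ε * (a * L) ^ 2) *
        (C₁ ^ 2 * (8 * a * L / μ)) ^ 2 := by gcongr
    _ = _ := by
        field_simp
        ring

/-- The iteration complexity and the oracle complexity of R-clipped-SSTM. -/
lemma complexity_bounds (hμ : 0 < μ) (hμL : μ ≤ L) (hβ : 0 < β) (hε : 0 < ε) (hR : 0 < R)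
    (hC₁ : 1 ≤ C₁) (hq : 1 < q) (hN₀ : 1 ≤ N₀) (hl : 2 ≤ logTerm N₀ τ β)
    (ha : a = aMin N₀ τ β) (hN : N₀ ≤ C₁ * √(8 * a * L / μ))
    (hτ2 : (2 : ℝ) ^ τ ≤ μ * R ^ 2 / ε) (hτ : τ * Real.log 2 ≤ Real.log (μ * R ^ 2 / ε))
    (hT : q ≤ L / (μ * β) * Real.log (μ * R ^ 2 / ε)) :
    ((N₀ * τ : ℕ) : ℝ) ≤ (250 * C₁ + 76800 * C₁ ^ 4) *
        (2 * (Real.log (500 * C₁) / Real.log q + 1)) * (√(L / μ) * Real.log (μ * R ^ 2 / ε) *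
        Real.log (L / (μ * β) * Real.log (μ * R ^ 2 / ε))) ∧
      (oracleCalls N₀ τ (batchSize L a σ R β N₀ τ) : ℝ) ≤ (250 * C₁ + 76800 * C₁ ^ 4) *
        (2 * (Real.log (500 * C₁) / Real.log q + 1)) *
        (max (√(L / μ) * Real.log (μ * R ^ 2 / ε)) (σ ^ 2 / (μ * ε)) *
          Real.log (L / (μ * β) * Real.log (μ * R ^ 2 / ε))) := by
  have hL : 0 < L := hμ.trans_le hμL
  have hN1 := iterations_le hμ hL (by linarith) (by linarith) (ha ▸ aMin_le hl) hN
  have hlT := logTerm_le hμ hμL hβ hC₁ hq hl hN₀ hN1 hτ hT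
  have horacle := oracleCalls_le (σ := σ) hμ hL hε hR
    (by rw [ha]; linarith [one_le_aMin N₀ τ β]) hN₀ hl hN hτ2
  set X := Real.log (μ * R ^ 2 / ε)
  set l := logTerm N₀ τ β
  set K' := 2 * (Real.log (500 * C₁) / Real.log q + 1)
  set Λ := Real.log (L / (μ * β) * X)
  have hτX' : (τ : ℝ) ≤ 25 / 17 * X := by
    nlinarith [Real.log_two_gt_d9, (τ.cast_nonneg : (0 : ℝ) ≤ τ)]
  have hX0 : 0 ≤ X := by linarith [(τ.cast_nonneg : (0 : ℝ) ≤ τ)]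
  have hNτ : ((N₀ * τ : ℕ) : ℝ) ≤ 125 * C₁ * (√(L / μ) * X) * (K' * Λ) := by
    push_cast
    calc (N₀ : ℝ) * τ ≤ (85 * C₁ * l * √(L / μ)) * (25 / 17 * X) := by gcongr
      _ = 125 * C₁ * (√(L / μ) * X) * l := by ring
      _ ≤ _ := by gcongr
  have hKΛ : 0 ≤ K' * Λ := by linarith
  have hs : 0 ≤ √(L / μ) * X := by positivity
  have hv : 0 ≤ σ ^ 2 / (μ * ε) := by positivity
  constructor
  · calc ((N₀ * τ : ℕ) : ℝ) ≤ 125 * C₁ * (√(L / μ) * X) * (K' * Λ) := hNτ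
      _ ≤ (250 * C₁ + 76800 * C₁ ^ 4) * (√(L / μ) * X) * (K' * Λ) := by
          gcongr
          nlinarith [pow_nonneg (by linarith : 0 ≤ C₁) 4]
      _ = _ := by ring
  · set M := max (√(L / μ) * X) (σ ^ 2 / (μ * ε))
    have hM1 : √(L / μ) * X ≤ M := le_max_left _ _
    have hM2 : σ ^ 2 / (μ * ε) ≤ M := le_max_right _ _
    calc _ ≤ 2 * ((N₀ * τ : ℕ) : ℝ) + 76800 * C₁ ^ 4 * (σ ^ 2 / (μ * ε)) * l := horacle
      _ ≤ 2 * (125 * C₁ * M * (K' * Λ)) + 76800 * C₁ ^ 4 * M * (K' * Λ) := by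
          gcongr
          exact hNτ.trans (by gcongr)
      _ = _ := by ring

end Complexity

end ClippedSSTM

theorem mainTheorem4 :
    -- the high-probability bound after `τ` restarts
    (∀ {n : ℕ} {Ω S : Type*} [MeasurableSpace Ω] [MeasurableSpace S]
      (Pr : Measure Ω) [IsProbabilityMeasure Pr] (P : Measure S) [IsProbabilityMeasure P]
      (f : EuclideanSpace ℝ (Fin n) → ℝ)
      (g : EuclideanSpace ℝ (Fin n) → S → EuclideanSpace ℝ (Fin n))
      (ξ : ℕ → ℕ → ℕ → Ω → S) (x₀ xs : EuclideanSpace ℝ (Fin n))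
      (μ L σ β a : ℝ) (N₀ τ : ℕ),
      0 < μ → 0 < L → 0 ≤ σ →
      IsStronglyConvex μ f → IsSmooth L f → (∀ x, f xs ≤ f x) →
      IsStochasticGradient P σ f g → IsIIDSample Pr P ξ →
      0 < β → β < 1 → 1 ≤ N₀ → 2 ≤ logTerm N₀ τ β →
      aMin N₀ τ β ≤ a → √5 * √(8 * a * L / μ) ≤ N₀ →
      ENNReal.ofReal (1 - β) ≤
        Pr {ω | f (output g L a σ (radius μ f x₀ xs) β N₀ τ (fun t k i => ξ t k i ω) x₀) - f xs
          ≤ (2 : ℝ)⁻¹ ^ τ * (f x₀ - f xs)}) ∧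
    -- the complexity: `K` depends on `C₁` and `q` only
    (∀ C₁ q : ℝ, √5 ≤ C₁ → 1 < q → ∃ K : ℝ, 0 < K ∧
      ∀ {n : ℕ} {Ω S : Type*} [MeasurableSpace Ω] [MeasurableSpace S]
        (Pr : Measure Ω) [IsProbabilityMeasure Pr] (P : Measure S) [IsProbabilityMeasure P]
        (f : EuclideanSpace ℝ (Fin n) → ℝ)
        (g : EuclideanSpace ℝ (Fin n) → S → EuclideanSpace ℝ (Fin n))
        (ξ : ℕ → ℕ → ℕ → Ω → S) (x₀ xs : EuclideanSpace ℝ (Fin n))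
        (μ L σ β ε R a : ℝ) (N₀ τ : ℕ),
        0 < μ → 0 < L → 0 ≤ σ →
        IsStronglyConvex μ f → IsSmooth L f → (∀ x, f xs ≤ f x) →
        IsStochasticGradient P σ f g → IsIIDSample Pr P ξ →
        0 < β → β < 1 → 0 < ε → R = radius μ f x₀ xs →
        τ = ⌈Real.logb 2 (μ * R ^ 2 / (2 * ε))⌉₊ →
        1 ≤ N₀ → 2 ≤ logTerm N₀ τ β →
        a = aMin N₀ τ β →
        √5 * √(8 * a * L / μ) ≤ N₀ → N₀ ≤ C₁ * √(8 * a * L / μ) →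
        ENNReal.ofReal (1 - β) ≤
          Pr {ω | f (output g L a σ R β N₀ τ (fun t k i => ξ t k i ω) x₀) - f xs ≤ ε} ∧
        (q ≤ L / (μ * β) * Real.log (μ * R ^ 2 / ε) →
          ((N₀ * τ : ℕ) : ℝ) ≤ K * (√(L / μ) * Real.log (μ * R ^ 2 / ε) *
            Real.log (L / (μ * β) * Real.log (μ * R ^ 2 / ε))) ∧
          (oracleCalls N₀ τ (batchSize L a σ R β N₀ τ) : ℝ) ≤
            K * (max (√(L / μ) * Real.log (μ * R ^ 2 / ε)) (σ ^ 2 / (μ * ε)) *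
              Real.log (L / (μ * β) * Real.log (μ * R ^ 2 / ε))))) ∧
    -- the parameters of the complexity bound can be chosen, for some numerical constant `C₁`
    (∃ C₁ : ℝ, √5 ≤ C₁ ∧ ∀ (μ L β : ℝ) (τ : ℕ),
      0 < μ → μ ≤ L → 0 < β → β < 1 → 1 ≤ τ →
      ∃ N₀ : ℕ, 1 ≤ N₀ ∧ 2 ≤ logTerm N₀ τ β ∧
        √5 * √(8 * aMin N₀ τ β * L / μ) ≤ N₀ ∧
        N₀ ≤ C₁ * √(8 * aMin N₀ τ β * L / μ)) := by
  refine ⟨?_, ?_, ?_⟩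
  · intro n Ω S _ _ Pr _ P _ f g ξ x₀ xs μ L σ β a N₀ τ hμ hL _ hc hf hxs hg hξ hβ _ hN₀ hl ha hN
    exact restartedSSTM_highProbability x₀ hμ hL hc hf hxs hg hξ hβ hN₀ hl ha hN
  · intro C₁ q hC₁ hq
    have hC₁1 : 1 ≤ C₁ := (Real.one_le_sqrt.2 (by norm_num)).trans hC₁
    have hlogq : 0 < Real.log q := Real.log_pos hq
    have hlogC : 0 ≤ Real.log (500 * C₁) := Real.log_nonneg (by linarith)
    refine ⟨(250 * C₁ + 76800 * C₁ ^ 4) * (2 * (Real.log (500 * C₁) / Real.log q + 1)),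
      by positivity, ?_⟩
    intro n Ω S _ _ Pr _ P _ f g ξ x₀ xs μ L σ β ε R a N₀ τ hμ hL _ hc hf hxs hg hξ hβ _ hε hR hτ
      hN₀ hl ha hN hN'
    have hΔ0 : 0 ≤ f x₀ - f xs := by linarith [hxs x₀]
    have hR2 : μ * R ^ 2 = 2 * (f x₀ - f xs) := by
      rw [hR, radius, Real.sq_sqrt (by positivity)]
      field_simp
    obtain ⟨hy1, hyτ, hτy, hτlog⟩ :=
      ceil_logb_bounds (by positivity) hτ (one_le_of_two_le_logTerm hl)
    have hy2 : 2 * (μ * R ^ 2 / (2 * ε)) = μ * R ^ 2 / ε := by field_simp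
    rw [hy2] at hτy hτlog
    have hΔε : ε < f x₀ - f xs := by
      rw [hR2, lt_div_iff₀ (by positivity)] at hy1
      linarith
    have hRpos : 0 < R := by
      rw [hR]
      exact Real.sqrt_pos.2 (div_pos (by linarith) hμ)
    -- The gap exceeds `ε > 0`, so `x₀ ≠ xs`; two distinct points force `μ ≤ L`.
    have hμL : μ ≤ L := hc.le_of_isSmooth hf (x := x₀) (y := xs) fun h => by
      rw [h, sub_self] at hΔε
      linarith
    refine ⟨?_, fun hT => complexity_bounds hμ hμL hβ hε hRpos hC₁1 hq hN₀ hl ha hN' hτy hτlog hT⟩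
    have hprob := restartedSSTM_highProbability x₀ hμ hL hc hf hxs hg hξ hβ hN₀ hl ha.ge hN
    rw [← hR] at hprob
    refine hprob.trans (measure_mono fun ω hω => ?_)
    have hω' : f (output g L a σ R β N₀ τ (fun t k i => ξ t k i ω) x₀) - f xs ≤
        (2 : ℝ)⁻¹ ^ τ * (f x₀ - f xs) := hω
    refine hω'.trans ?_
    -- Since `μR² = 2 (f x₀ - f xs)`, the choice of `τ` says that `(f x₀ - f xs)/ε ≤ 2^τ`.
    rw [inv_pow, ← div_eq_inv_mul, div_le_iff₀ (by positivity)]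
    rw [hR2, div_le_iff₀ (by positivity)] at hyτ
    linarith
  · refine ⟨2 * √5, by linarith [Real.sqrt_nonneg 5], ?_⟩
    intro μ L β τ hμ hμL hβ hβ1 hτ
    exact exists_iterations hμ hμL hβ hβ1 hτ
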